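/- Let $\mathbb{T}$ be the Tribonacci sequence over $\{a,b,c\}$, i.e. the fixed point of $\sigma(a)=ab$, $\sigma(b)=ac$, $\sigma(c)=a$, and let $\mathbb{T}[1,n]$ be its prefix of length $n$. Let $T_m=\sigma^m(a)$ and $t_m=|T_m|$ for $m\ge 0$. For a nonempty factor $\omega$ of $\mathbb{T}$ let $\omega_p$ ($p\ge1$) be its $p$-th occurrence (overlaps allowed) and $P(\omega,p)$ the position of the last letter of $\omega_p$. A cube $\omega_p\omega_{p+1}\omega_{p+2}$ consists of three consecutive occurrences of $\omega$ that directly follow one another, i.e. $P(\omega,p+1)=P(\omega,p)+|\omega|$ and $P(\omega,p+2)=P(\omega,p+1)+|\omega|$. Let $D(n)$ be the number of pairs $(\omega,p)$ for which $\omega_p\omega_{p+1}\omega_{p+2}$ is a cube contained in $\mathbb{T}[1,n]$, and $d(n)$ the number of those pairs for which this cube ends at position $n$. Let $k_0=0$, $k_1=k_2=1$, $k_m=k_{m-1}+k_{m-2}+k_{m-3}-1$ for $m\ge3$; let $K_1=a$, $K_2=b$, $K_3=c$, and for $m\geq 4$ let $K_m$ be the last letter of $T_{m-1}$ followed by the first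 $k_m-1$ letters of $T_{m-3}$. Let $\Gamma_m=[P(K_m,1),P(K_m,1)+1,\dots,P(K_m,1)+t_{m-1}-1]$ (this is $\Gamma_{m,1}$), let $d(\Gamma_m)$ be the vector of the values of $d$ on $\Gamma_m$, and $\sum d(\Gamma_m)$ the sum of its entries. Write $0^r$, $1^r$ for blocks of $r$ equal entries, and put $\lambda_m=\frac{-t_{m-2}+5t_{m-4}+1}{2}$, $\mu_m=\frac{t_{m-2}-3t_{m-4}-1}{2}$. Then the following hold. (0) $d(n)$ and $D(n)$ are finite and $D(n)=\sum_{i=1}^n d(i)$. For $m\ge7$: $\min\Gamma_m=\frac{t_m+t_{m-2}-1}{2}$, $\max\Gamma_m=\frac{t_{m+1}+t_{m-1}-3}{2}$, and $\max\Gamma_m+1=\min\Gamma_{m+1}$; $\lambda_m$ and $\mu_m$ are nonnegative integers. Every $n\ge52$ lies in $\Gamma_m$ for exactly one $m\ge7$. (1) $d(n)=0$ for $n\le51$; $\Gamma_7=[52,\dots,95]$ and $d(\Gamma_7)=[0^6,1,0^{37}]$; $\Gamma_8=[96,\dots,176]$ and $d(\Gamma_8)=[0^{11},1^2,0^{30},1,0^{37}]$;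 $\Gamma_9=[177,\dots,325]$ and $d(\Gamma_9)=[0^{20},1^4,0^6,1,0^{48},1^2,0^{30},1,0^{37}]$; and for $m\ge10$ $$d(\Gamma_m)=[d(\Gamma_{m-3}),d(\Gamma_{m-2}),d(\Gamma_{m-1})]+[0^{\lambda_m},1^{\mu_m},0^{t_{m-2}+t_{m-3}}],$$ hence $\sum d(\Gamma_m)=\sum d(\Gamma_{m-3})+\sum d(\Gamma_{m-2})+\sum d(\Gamma_{m-1})+\mu_m$. (2) For $m\ge7$: $D(\min\Gamma_{m+1})=D(\max\Gamma_m)$; $$\sum d(\Gamma_m)=\tfrac{m}{22}(7t_m-13t_{m-1}+t_{m-2})+\tfrac1{44}(-41t_m+74t_{m-1}-7t_{m-2})+\tfrac14;$$ $$D(\max\Gamma_m)=\sum_{j=7}^m\sum d(\Gamma_j)=\tfrac{m}{44}(9t_m-12t_{m-1}-5t_{m-2})+\tfrac{3}{11}(-2t_m+2t_{m-1}+t_{m-2})+\tfrac m4.$$ (3) For $m\ge7$ put $\theta^1_m=\min\Gamma_m$, $\eta^1_m=\theta^1_m+\lambda_m$, $\eta^2_m=\theta^1_m+\lambda_m+\mu_m$,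 $\theta^2_m=\theta^1_m+|\Gamma_{m-3}|$, $\theta^3_m=\theta^1_m+|\Gamma_{m-3}|+|\Gamma_{m-2}|$. Then $\theta_m^1=\frac{t_m+t_{m-2}-1}{2}$, $\eta^1_m=\frac{t_m+5t_{m-4}}{2}$, $\eta^2_m=\theta^2_m=\frac{3t_{m-1}-t_{m-3}-1}{2}$, $\theta^3_m=\frac{3t_{m-1}+t_{m-3}-1}{2}$ and $\theta^1_m<\eta^1_m<\eta^2_m=\theta^2_m<\theta^3_m<\theta^1_{m+1}$. If $n\ge326$ and $n\in\Gamma_m$ with $m\geq 7$, then $m\ge10$ and $$\sum_{i=\min\Gamma_m}^n d(i)=\begin{cases}\sum_{i=\min\Gamma_{m-3}}^{n-t_{m-1}}d(i),&\theta^1_m\le n<\eta^1_m;\\ \sum_{i=\min\Gamma_{m-3}}^{n-t_{m-1}}d(i)+n-\eta^1_m+1,&\eta^1_m\le n<\theta^2_m;\\ \sum_{i=\min\Gamma_{m-2}}^{n-t_{m-1}}d(i)+\sum d(\Gamma_{m-3})+\mu_m,&\theta^2_m\le n<\theta^3_m;\\ \sum_{i=\min\Gamma_{m-1}}^{n-t_{m-1}}d(i)+\sum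 d(\Gamma_{m-3})+\sum d(\Gamma_{m-2})+\mu_m,&\text{otherwise,}\end{cases}$$ and $D(n)=D(\max\Gamma_{m-1})+\sum_{i=\min\Gamma_m}^n d(i)$. (4) Consequently the following algorithm computes $D(n)$ for every $n\ge0$, using $O(\log n+1)$ elementary operations (additions, subtractions, multiplications, divisions and comparisons of integers, and updates of an index): if $n\le325$, sum the values of $d$ given in (1); if $n\ge326$, search upwards for the $m\geq 10$ with $n\in\Gamma_m$, evaluate $D(\max\Gamma_{m-1})$ by (2), evaluate $\sum_{i=\min\Gamma_m}^n d(i)$ by the recursion (3) with the block sums from (2), stopping at the values in (1) as soon as the index is at most $9$, and add the two numbers. -/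

import Mathlib

namespace Trib

/-- The alphabet `{a, b, c}`. -/
inductive Letter
  | a
  | b
  | c
  deriving DecidableEq

/-- The substitution `a ↦ ab`, `b ↦ ac`, `c ↦ a` on letters. -/
def sigma : Letter → List Letter
  | .a => [.a, .b]
  | .b => [.a, .c]
  | .c => [.a]

/-- `T_m = σ^m(a)`. -/
def word : ℕ → List Letter
  | 0 => [.a]
  | m + 1 => (word m).flatMap sigma

/-- The Tribonacci numbers `t_m = |T_m|`: `1, 2, 4, 7, 13, 24, …` -/
def t (m : ℕ) : ℕ := (word m).length

/-- The letter of the Tribonacci sequence at position `i + 1`. Each `T_m` is a prefix of `T_{m+1}`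
and `|T_i| > i`, so this letter is read off from `T_i`; the default value is never used. -/
def letterAt (i : ℕ) : Letter := (word i).getD i .a

/-- The prefix `𝕋[1,n]` of length `n` of the Tribonacci sequence. -/
def pre (n : ℕ) : List Letter := (List.range n).map letterAt

/-- `P(ω,p)`: the position of the last letter of the `p`-th occurrence of `ω` (`p ≥ 1`).
An occurrence of `ω` has its last letter at position `e` iff `ω` is a suffix of `𝕋[1,e]`;
overlapping occurrences are counted. -/
noncomputable def pos (w : List Letter) (p : ℕ) : ℕ :=
  Nat.nth (fun e => w <:+ pre e) (p - 1)

/-- `ω_p ω_{p+1} ω_{p+2}` is a cube of the Tribonacci sequence: the `p`-th, `(p+1)`-st and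
`(p+2)`-nd occurrences of the nonempty factor `ω` directly follow one another. -/
def IsCube (w : List Letter) (p : ℕ) : Prop :=
  w ≠ [] ∧ (∃ e, w <:+ pre e) ∧ 1 ≤ p ∧
    pos w (p + 1) = pos w p + w.length ∧ pos w (p + 2) = pos w (p + 1) + w.length

/-- The pairs `(ω, p)` such that the cube `ω_p ω_{p+1} ω_{p+2}` lies in `𝕋[1,n]`. -/
def cubesIn (n : ℕ) : Set (List Letter × ℕ) :=
  {x | IsCube x.1 x.2 ∧ pos x.1 (x.2 + 2) ≤ n}

/-- The pairs `(ω, p)` such that the cube `ω_p ω_{p+1} ω_{p+2}` ends at position `n`. -/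
def cubesAt (n : ℕ) : Set (List Letter × ℕ) :=
  {x | IsCube x.1 x.2 ∧ pos x.1 (x.2 + 2) = n}

/-- `D(n)`: the number of repeated cubes in `𝕋[1,n]`. -/
noncomputable def D (n : ℕ) : ℕ := (cubesIn n).ncard

/-- `d(n)`: the number of cubes ending at position `n`. -/
noncomputable def d (n : ℕ) : ℕ := (cubesAt n).ncard

/-- The kernel numbers. -/
def kerNum : ℕ → ℕ
  | 0 => 0
  | 1 => 1
  | 2 => 1
  | m + 3 => kerNum (m + 2) + kerNum (m + 1) + kerNum m - 1

/-- The kernel words `K_m`, `m ≥ 1`: `K_1 = a`, `K_2 = b`, `K_3 = c`, and for `m ≥ 4` the last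
letter of `T_{m-1}` followed by the first `k_m - 1` letters of `T_{m-3}`. -/
def kerWord : ℕ → List Letter
  | 0 => []
  | 1 => [.a]
  | 2 => [.b]
  | 3 => [.c]
  | m + 4 => (word (m + 3)).getLastD .a :: (word (m + 1)).take (kerNum (m + 4) - 1)

/-- The vector `Γ_{m,p} = [P(K_m,p), …, P(K_m,p) + t_{m-1} - 1]`. -/
noncomputable def gamma (m p : ℕ) : List ℕ := List.range' (pos (kerWord m) p) (t (m - 1))

/-- `min Γ_{m,1}`. -/
noncomputable def gammaMin (m : ℕ) : ℕ := pos (kerWord m) 1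

/-- `max Γ_{m,1}`. -/
noncomputable def gammaMax (m : ℕ) : ℕ := pos (kerWord m) 1 + t (m - 1) - 1

/-- The vector `d(Γ_{m,1})`. -/
noncomputable def dGamma (m : ℕ) : List ℕ := (gamma m 1).map d

/-- Entrywise sum of two vectors. -/
def vadd (u v : List ℕ) : List ℕ := List.zipWith (· + ·) u v

/-- The number `(-t_{m-2} + 5 t_{m-4} + 1) / 2`. -/
def lead (m : ℕ) : ℕ := (5 * t (m - 4) + 1 - t (m - 2)) / 2

/-- The number `(t_{m-2} - 3 t_{m-4} - 1) / 2`. -/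
def ones (m : ℕ) : ℕ := (t (m - 2) - (3 * t (m - 4) + 1)) / 2

/-- The vector of `r` equal entries `x`. -/
abbrev rep (r x : ℕ) : List ℕ := List.replicate r x

noncomputable def theta1 (m : ℕ) : ℕ := gammaMin m
noncomputable def eta1 (m : ℕ) : ℕ := gammaMin m + lead m
noncomputable def eta2 (m : ℕ) : ℕ := gammaMin m + lead m + ones m
noncomputable def theta2 (m : ℕ) : ℕ := gammaMin m + (gamma (m - 3) 1).length
noncomputable def theta3 (m : ℕ) : ℕ :=
  gammaMin m + (gamma (m - 3) 1).length + (gamma (m - 2) 1).length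

/-! ### The algorithm, with a count of elementary operations

A computation returns its value with the number of elementary operations performed. The elementary
operations are one addition, subtraction, multiplication, integer division or comparison
of integers, and one update of a loop index. -/

structure Counted (α : Type) where
  val : α
  cost : ℕ

instance : Monad Counted where
  pure x := ⟨x, 0⟩
  bind x f := ⟨(f x.val).val, x.cost + (f x.val).cost⟩

def tick : Counted Unit := ⟨(), 1⟩
def cAdd (x y : ℤ) : Counted ℤ := ⟨x + y, 1⟩
def cSub (x y : ℤ) : Counted ℤ := ⟨x - y, 1⟩
def cMul (x y : ℤ) : Counted ℤ := ⟨x * y, 1⟩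
def cDiv (x y : ℤ) : Counted ℤ := ⟨x / y, 1⟩
def cLt (x y : ℤ) : Counted Bool := ⟨decide (x < y), 1⟩

/-- `α x + β y + γ z`. -/
def cLin (α β γ x y z : ℤ) : Counted ℤ := do
  let u ← cMul α x
  let v ← cMul β y
  let w ← cMul γ z
  let s ← cAdd u v
  cAdd s w

/-- `∑ d(Γ_{m,1})` from `(x, y, z) = (t_m, t_{m-1}, t_{m-2})`, by its closed form
`(2m(7x - 13y + z) + (-41x + 74y - 7z) + 11) / 44`. -/
def blockSum (m x y z : ℤ) : Counted ℤ := do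
  let u ← cLin 7 (-13) 1 x y z
  let v ← cLin (-41) 74 (-7) x y z
  let s ← cLin 2 1 11 (← cMul m u) v 1
  cDiv s 44

/-- `D(max Γ_{m,1})` from `(x, y, z) = (t_m, t_{m-1}, t_{m-2})`, by its closed form
`(m(9x - 12y - 5z) + 12(-2x + 2y + z) + 11m) / 44`. -/
def prefixSum (m x y z : ℤ) : Counted ℤ := do
  let u ← cLin 9 (-12) (-5) x y z
  let v ← cLin (-2) 2 1 x y z
  let s ← cLin 1 12 11 (← cMul m u) v m
  cDiv s 44

/-- The positions `i` in `Γ_{m,1}` with `d(i) = 1`, for `m = 7, 8, 9`. -/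
def ends : ℕ → List ℤ
  | 7 => [58]
  | 8 => [107, 108, 139]
  | 9 => [197, 198, 199, 200, 207, 256, 257, 288]
  | _ => []

/-- The number of entries of a list that are at most `n`. -/
def countUpTo (n : ℤ) : List ℤ → Counted ℤ
  | [] => pure 0
  | e :: l => do
    let r ← countUpTo n l
    if (← cLt n e) then pure r else cAdd r 1

/-- `∑_{i = min Γ_{m,1}}^{n} d(i)` for `n ∈ Γ_{m,1}`, where `(x, y, z) = (t_m, t_{m-1}, t_{m-2})`:
read off from a table if `m ≤ 9`, and by the four-case recursion if `m ≥ 10`. -/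
def partialSum : ℕ → ℤ → ℤ → ℤ → ℤ → Counted ℤ
  | m + 10, x, y, z, n => do
    let t3 ← cSub (← cSub x y) z
    let t4 ← cSub (← cSub y z) t3
    let t5 ← cSub (← cSub z t3) t4
    let n' ← cSub n y
    let e1 ← cDiv (← cAdd x (← cMul 5 t4)) 2
    if (← cLt n e1) then
      tick
      partialSum (m + 7) t3 t4 t5 n'
    else
      let th2 ← cDiv (← cLin 3 (-1) (-1) y t3 1) 2
      if (← cLt n th2) then
        tick
        let s ← partialSum (m + 7) t3 t4 t5 n'
        cAdd (← cAdd s (← cSub n e1)) 1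
      else
        let one ← cDiv (← cLin 1 (-3) (-1) z t4 1) 2
        tick
        let b3 ← blockSum (m + 7 : ℕ) t3 t4 t5
        let th3 ← cDiv (← cLin 3 1 (-1) y t3 1) 2
        if (← cLt n th3) then
          tick
          let s ← partialSum (m + 8) z t3 t4 n'
          cAdd (← cAdd s b3) one
        else
          tick
          let b2 ← blockSum (m + 8 : ℕ) z t3 t4
          tick
          let s ← partialSum (m + 9) y z t3 n'
          cAdd (← cAdd (← cAdd s b3) b2) one
  | m, _, _, _, n => countUpTo n (ends m)

/-- Searches upwards from `m`, with `(x, y, z) = (t_m, t_{m-1}, t_{m-2})`, for the block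
`Γ_{m,1}` that contains `n`; returns `m` with the three Tribonacci numbers. The first argument is
only a bound on the number of rounds that makes the recursion structural. -/
def findBlock : ℕ → ℕ → ℤ → ℤ → ℤ → ℤ → Counted (ℕ × ℤ × ℤ × ℤ)
  | 0, m, x, y, z, _ => pure (m, x, y, z)
  | f + 1, m, x, y, z, n => do
    let x' ← cAdd (← cAdd x y) z
    let next ← cDiv (← cSub (← cAdd x' y) 1) 2
    if (← cLt n next) then pure (m, x, y, z)
    else
      tick
      findBlock f (m + 1) x' x y n

/-- The algorithm that computes `D(n)`. It starts its search with
`(t_10, t_9, t_8) = (504, 274, 149)`. -/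
def algD (n : ℕ) : Counted ℤ := do
  if (← cLt 325 n) then
    let (m, x, y, z) ← findBlock n 10 504 274 149 n
    let s ← partialSum m x y z n
    let t3 ← cSub (← cSub x y) z
    let m' ← cSub m 1
    let q ← prefixSum m' y z t3
    cAdd q s
  else countUpTo n (ends 7 ++ ends 8 ++ ends 9)

end Trib

/-! Positions are counted from `0`, and `blockStart` sends position `i` to the start of the image of
its letter. Every σ(x) begins with `a`, so the `k`-th image of any position is followed by the
palindromic prefix `pal k`. Conversely, desubstitution shows that two equal words at different
positions lie, at the same offset, in two copies of `pal k` starting at `blockStart^[k] s` and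
`blockStart^[k] s'` (`Match.exists_iterate`).

For a cube of period L the repeated word has length 2L, while `pal k` is shorter than 2|σ^k(b)|.
This forces the letter at `s` to be `c` and `s' = s + 1`. Hence L is a Tribonacci number t_k, and
each cube of that period lies in a run attached to an occurrence of `c` (`Match.exists_c`). The same
rigidity makes cube roots primitive, so the pairs (ω, p) ending at n correspond to periods, and d(n)
counts those periods (`d_eq_card`).

K_m is `pal (m - 4)` between two copies of the letter that follows it, an image of `aa`; its first
occurrence shows that Γ_m is the interval from `palLen (m - 1) + 1` to `palLen m` (`pos_kerWord`).
Up to `palLen m` the sequence has period t_{m-1}. A cube ending in Γ_m and starting at or after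
t_{m-1} is therefore a translate of one ending in Γ_{m-3}, Γ_{m-2} or Γ_{m-1}. Any other cube has
period t_{m-4} and lies in the run of the first `c`, which produces the single block of ones
(`d_eq_d_sub_add`). The sums, closed forms and algorithm all follow from this recursion. -/

namespace Trib

/-! ### The fixed point and its block structure -/

theorem word_prefix_succ (m : ℕ) : word m <+: word (m + 1) := by
  induction m with
  | zero => exact ⟨[.b], rfl⟩
  | succ m ih =>
    obtain ⟨u, hu⟩ := ih
    refine ⟨u.flatMap sigma, ?_⟩
    change (word m).flatMap sigma ++ _ = (word (m + 1)).flatMap sigma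
    rw [← hu, List.flatMap_append]

theorem word_prefix {m n : ℕ} (h : m ≤ n) : word m <+: word n := by
  induction n, h using Nat.le_induction with
  | base => exact List.prefix_refl _
  | succ n _ ih => exact ih.trans (word_prefix_succ n)

theorem word_succ (m : ℕ) : word (m + 1) = (word m).flatMap sigma := rfl

/-- `T_{m+3} = T_{m+2} T_{m+1} T_m`. -/
theorem word_add_three (m : ℕ) : word (m + 3) = word (m + 2) ++ word (m + 1) ++ word m := by
  induction m with
  | zero => rfl
  | succ m ih =>
    calc word (m + 4) = (word (m + 3)).flatMap sigma := rfl
      _ = (word (m + 2) ++ word (m + 1) ++ word m).flatMap sigma := by rw [ih]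
      _ = _ := by rw [List.flatMap_append, List.flatMap_append]; rfl

@[simp] theorem t_zero : t 0 = 1 := rfl
@[simp] theorem t_one : t 1 = 2 := rfl
@[simp] theorem t_two : t 2 = 4 := rfl

theorem t_add_three (m : ℕ) : t (m + 3) = t (m + 2) + t (m + 1) + t m := by
  simp [t, word_add_three, add_assoc]

theorem t_pos (m : ℕ) : 0 < t m := by
  have := (word_prefix (Nat.zero_le m)).length_le
  exact this

theorem t_lt_succ (m : ℕ) : t m < t (m + 1) := by
  induction m using Nat.strong_induction_on with
  | _ m ih =>
    match m with
    | 0 => decide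
    | 1 => decide
    | m + 2 =>
      have := t_add_three m
      have := t_pos m
      have := t_pos (m + 1)
      show t (m + 2) < t (m + 3)
      omega

theorem t_strictMono : StrictMono t := strictMono_nat_of_lt_succ t_lt_succ

theorem lt_t (m : ℕ) : m < t m := by
  induction m with
  | zero => decide
  | succ m ih => have := t_lt_succ m; omega

theorem word_getElem_eq {m i : ℕ} (h : i < t m) : (word m)[i]'h = letterAt i := by
  have h' : i < (word i).length := lt_t i
  unfold letterAt
  rw [List.getD_eq_getElem _ _ h']
  rcases le_total m i with hm | hm
  · exact (word_prefix hm).getElem h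
  · exact ((word_prefix hm).getElem h').symm

@[simp] theorem pre_length (n : ℕ) : (pre n).length = n := by simp [pre]

theorem pre_succ (n : ℕ) : pre (n + 1) = pre n ++ [letterAt n] := by
  simp [pre, List.range_succ]

theorem pre_getElem {n i : ℕ} (h : i < (pre n).length) : (pre n)[i] = letterAt i := by
  simp [pre]

theorem pre_t (m : ℕ) : pre (t m) = word m := by
  apply List.ext_getElem
  · simp [t]
  · intro i h1 h2
    rw [pre_getElem, word_getElem_eq h2]

theorem pre_prefix {m n : ℕ} (h : m ≤ n) : pre m <+: pre n := by
  induction n, h using Nat.le_induction with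
  | base => exact List.prefix_refl _
  | succ n _ ih => exact ih.trans ⟨[letterAt n], (pre_succ n).symm⟩

/-- The position at which the image of the `i`-th letter starts (all positions from `0`). -/
def blockStart (i : ℕ) : ℕ := ((pre i).flatMap sigma).length

/-- `𝕋` is fixed by the substitution. -/
theorem pre_blockStart (i : ℕ) : pre (blockStart i) = (pre i).flatMap sigma := by
  have h1 : pre i <+: word i := by rw [← pre_t]; exact pre_prefix (lt_t i).le
  have h2 : (pre i).flatMap sigma <+: pre (t (i + 1)) := by
    obtain ⟨u, hu⟩ := h1
    rw [pre_t, word_succ, ← hu, List.flatMap_append]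
    exact List.prefix_append _ _
  have h3 : blockStart i ≤ t (i + 1) := by
    have := h2.length_le
    rwa [pre_length] at this
  -- Both words are prefixes of T_{i+1} and have the same length.
  exact (List.prefix_of_prefix_length_le (pre_prefix h3) h2 (by simp [blockStart])).eq_of_length
    (by simp [blockStart])

@[simp] theorem blockStart_zero : blockStart 0 = 0 := rfl

theorem blockStart_succ (i : ℕ) :
    blockStart (i + 1) = blockStart i + (sigma (letterAt i)).length := by
  simp [blockStart, pre_succ]

theorem blockStart_t (m : ℕ) : blockStart (t m) = t (m + 1) := by
  rw [blockStart, pre_t]; rfl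

theorem sigma_length_pos (x : Letter) : 0 < (sigma x).length := by cases x <;> decide

theorem sigma_length_le (x : Letter) : (sigma x).length ≤ 2 := by cases x <;> decide

theorem blockStart_strictMono : StrictMono blockStart :=
  strictMono_nat_of_lt_succ fun i => by
    have := sigma_length_pos (letterAt i)
    rw [blockStart_succ]; omega

theorem letterAt_blockStart_add {i x : ℕ} (h : x < (sigma (letterAt i)).length) :
    letterAt (blockStart i + x) = (sigma (letterAt i))[x] := by
  have h1 : pre (blockStart (i + 1)) = pre (blockStart i) ++ sigma (letterAt i) := by
    rw [pre_blockStart, pre_blockStart, pre_succ]; simp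
  have hlt : blockStart i + x < (pre (blockStart (i + 1))).length := by
    rw [pre_length, blockStart_succ]; omega
  rw [← pre_getElem hlt]
  simp [h1]

theorem letterAt_blockStart (i : ℕ) : letterAt (blockStart i) = .a := by
  have := letterAt_blockStart_add (i := i) (x := 0) (sigma_length_pos _)
  rw [Nat.add_zero] at this
  rw [this]
  cases letterAt i <;> rfl

/-- The cyclic successor of a letter. -/
def next : Letter → Letter
  | .a => .b
  | .b => .c
  | .c => .a

theorem next_injective : Function.Injective next := by
  intro x y h; cases x <;> cases y <;> first | rfl | cases h

/-- Uniform in the letter: the image of `c` has length one, so the position is then the start of the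
next block, and `a` is again the successor of `c`. A block start and the position after it thus
determine the preimage letter. -/
theorem letterAt_blockStart_add_one (i : ℕ) : letterAt (blockStart i + 1) = next (letterAt i) := by
  rcases hx : letterAt i with _ | _ | _
  · rw [letterAt_blockStart_add (by rw [hx]; decide)]; simp [hx, sigma, next]
  · rw [letterAt_blockStart_add (by rw [hx]; decide)]; simp [hx, sigma, next]
  · have : blockStart i + 1 = blockStart (i + 1) := by rw [blockStart_succ, hx]; rfl
    rw [this, letterAt_blockStart]; rfl

/-- The last letter of the image of a letter is its cyclic successor. -/
theorem letterAt_blockStart_succ_sub_one (i : ℕ) :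
    letterAt (blockStart (i + 1) - 1) = next (letterAt i) := by
  rcases hx : letterAt i with _ | _ | _
  · have : blockStart (i + 1) - 1 = blockStart i + 1 := by rw [blockStart_succ, hx]; rfl
    rw [this, letterAt_blockStart_add_one, hx]
  · have : blockStart (i + 1) - 1 = blockStart i + 1 := by rw [blockStart_succ, hx]; rfl
    rw [this, letterAt_blockStart_add_one, hx]
  · have : blockStart (i + 1) - 1 = blockStart i := by rw [blockStart_succ, hx]; rfl
    rw [this, letterAt_blockStart]; rfl

theorem exists_blockStart (p : ℕ) :
    ∃ i, p = blockStart i ∨ (p = blockStart i + 1 ∧ letterAt i ≠ .c) := by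
  induction p with
  | zero => exact ⟨0, Or.inl rfl⟩
  | succ p ih =>
    obtain ⟨i, h | ⟨h, hc⟩⟩ := ih
    · by_cases hc : letterAt i = .c
      · exact ⟨i + 1, Or.inl (by rw [blockStart_succ, hc, h]; rfl)⟩
      · exact ⟨i, Or.inr ⟨by rw [h], hc⟩⟩
    · refine ⟨i + 1, Or.inl ?_⟩
      rw [blockStart_succ, h]
      rcases hx : letterAt i with _ | _ | _ <;> simp_all [sigma]

theorem eq_blockStart_of_letterAt_eq_a {p : ℕ} (h : letterAt p = .a) : ∃ i, p = blockStart i := by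
  obtain ⟨i, h' | ⟨rfl, hc⟩⟩ := exists_blockStart p
  · exact ⟨i, h'⟩
  · rw [letterAt_blockStart_add_one] at h
    cases hx : letterAt i <;> simp_all [next]

theorem exists_blockStart_of_letterAt_ne_a {p : ℕ} (h : letterAt p ≠ .a) :
    ∃ i, p = blockStart i + 1 ∧ letterAt i ≠ .c := by
  obtain ⟨i, rfl | h'⟩ := exists_blockStart p
  · exact absurd (letterAt_blockStart i) h
  · exact ⟨i, h'⟩

/-! ### Iterated block starts and the lengths of the images of letters -/

/-- `|σ^k(x)|`. -/
def imageLen : ℕ → Letter → ℕ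
  | 0, _ => 1
  | k + 1, .a => imageLen k .a + imageLen k .b
  | k + 1, .b => imageLen k .a + imageLen k .c
  | k + 1, .c => imageLen k .a

theorem iterate_blockStart_succ (k s : ℕ) :
    blockStart^[k] (s + 1) = blockStart^[k] s + imageLen k (letterAt s) := by
  induction k generalizing s with
  | zero => rfl
  | succ k ih =>
    rw [Function.iterate_succ_apply, Function.iterate_succ_apply, blockStart_succ]
    have h1 := letterAt_blockStart s
    have h2 := letterAt_blockStart_add_one s
    rcases hx : letterAt s with _ | _ | _
    · simp only [sigma, List.length_cons, List.length_nil]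
      rw [← add_assoc, ih, ih, h1, h2, hx, imageLen, next, add_assoc]
    · simp only [sigma, List.length_cons, List.length_nil]
      rw [← add_assoc, ih, ih, h1, h2, hx, imageLen, next, add_assoc]
    · simp only [sigma, List.length_cons, List.length_nil]
      rw [zero_add, ih, h1, imageLen]

theorem iterate_blockStart_strictMono (k : ℕ) : StrictMono (blockStart^[k]) :=
  blockStart_strictMono.iterate k

theorem iterate_blockStart_t (k j : ℕ) : blockStart^[k] (t j) = t (j + k) := by
  induction k with
  | zero => rfl
  | succ k ih => rw [Function.iterate_succ_apply', ih, blockStart_t]; rfl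

theorem iterate_blockStart_zero (k : ℕ) : blockStart^[k] 0 = 0 :=
  Function.iterate_fixed blockStart_zero k

theorem imageLen_a (k : ℕ) : imageLen k .a = t k := by
  have h := iterate_blockStart_succ k 0
  rw [iterate_blockStart_zero, zero_add, zero_add] at h
  have h' := iterate_blockStart_t k 0
  rw [t_zero, zero_add] at h'
  rw [← h', h]; rfl

theorem imageLen_c (k : ℕ) : imageLen (k + 1) .c = t k := by
  rw [imageLen, imageLen_a]

/-! ### The palindromic prefixes -/

/-- The palindromic prefixes `ε, a, aba, abacaba, …`. -/
def pal : ℕ → List Letter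
  | 0 => []
  | k + 1 => (pal k).flatMap sigma ++ [.a]

theorem pal_succ_eq (k : ℕ) : pal (k + 1) = word k ++ pal k := by
  induction k with
  | zero => rfl
  | succ k ih =>
    calc pal (k + 2) = (pal (k + 1)).flatMap sigma ++ [.a] := rfl
      _ = _ := by rw [ih, List.flatMap_append, List.append_assoc, ← ih]; rfl

/-- The lengths `0, 1, 3, 7, 14, …` of the palindromic prefixes. -/
def palLen (k : ℕ) : ℕ := (pal k).length

@[simp] theorem palLen_zero : palLen 0 = 0 := rfl

theorem palLen_succ (k : ℕ) : palLen (k + 1) = palLen k + t k := by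
  simp [palLen, pal_succ_eq, t, add_comm]

/-- Applying σ to a word followed by `pal k` gives its image followed by σ(`pal k`), and the next
block begins with `a` whatever its letter is. This extra `a` completes `pal (k + 1)`. -/
theorem pre_iterate_add_palLen (k s : ℕ) :
    pre (blockStart^[k] s + palLen k) = pre (blockStart^[k] s) ++ pal k ∧
      blockStart^[k + 1] s + palLen (k + 1) = blockStart (blockStart^[k] s + palLen k) + 1 := by
  have key : ∀ k, pre (blockStart^[k] s + palLen k) = pre (blockStart^[k] s) ++ pal k →
      blockStart^[k + 1] s + palLen (k + 1) = blockStart (blockStart^[k] s + palLen k) + 1 := by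
    intro k h
    rw [Function.iterate_succ_apply', blockStart, blockStart, h]
    simp [palLen, pal, add_assoc]
  have main : ∀ k, pre (blockStart^[k] s + palLen k) = pre (blockStart^[k] s) ++ pal k := by
    intro k
    induction k with
    | zero => simp [pal, palLen]
    | succ k ih =>
      rw [key k ih, pre_succ, pre_blockStart, ih, letterAt_blockStart, List.flatMap_append,
        Function.iterate_succ_apply', pre_blockStart, pal, List.append_assoc]
  exact ⟨main k, key k (main k)⟩

theorem iterate_blockStart_add_palLen_succ (k s : ℕ) :
    blockStart^[k + 1] s + palLen (k + 1) = blockStart (blockStart^[k] s + palLen k) + 1 :=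
  (pre_iterate_add_palLen k s).2

theorem palLen_succ_eq_blockStart (k : ℕ) : palLen (k + 1) = blockStart (palLen k) + 1 := by
  have := iterate_blockStart_add_palLen_succ k 0
  simpa [iterate_blockStart_zero] using this

theorem letterAt_iterate_add {k s x : ℕ} (h : x < palLen k) :
    letterAt (blockStart^[k] s + x) = (pal k)[x]'h := by
  have h1 := (pre_iterate_add_palLen k s).1
  have hlt : blockStart^[k] s + x < (pre (blockStart^[k] s + palLen k)).length := by simpa
  rw [← pre_getElem hlt]
  simp [h1]
  rfl

theorem letterAt_palLen (k : ℕ) : letterAt (palLen k) = next^[k] .a := by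
  induction k with
  | zero => rfl
  | succ k ih =>
    rw [palLen_succ_eq_blockStart, letterAt_blockStart_add_one, ih, Function.iterate_succ_apply']

/-- Together with `letterAt_palLen` and the period three of `next`, this makes the last letter of
T_{k+3} the letter that follows `pal k`, as needed for the kernel words. -/
theorem letterAt_t_sub_one (k : ℕ) : letterAt (t k - 1) = next^[k] .a := by
  induction k with
  | zero => rfl
  | succ k ih =>
    obtain ⟨i, hi⟩ : ∃ i, t k = i + 1 := ⟨t k - 1, by have := t_pos k; omega⟩
    rw [← blockStart_t, hi, letterAt_blockStart_succ_sub_one, Function.iterate_succ_apply', ← ih,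
      hi, Nat.add_sub_cancel]

/-! ### Repetitions -/

/-- The words of length `N` at positions `p` and `q` agree. -/
def Match (p q N : ℕ) : Prop := ∀ x < N, letterAt (p + x) = letterAt (q + x)

theorem Match.blockStart_add {i j N : ℕ} (h : Match i j N) {y : ℕ} (hy : y ≤ N) :
    blockStart (i + y) + blockStart j = blockStart (j + y) + blockStart i := by
  induction y with
  | zero => simp [add_comm]
  | succ y ih =>
    have := ih (by omega)
    rw [← add_assoc, ← add_assoc, blockStart_succ, blockStart_succ, h y (by omega)]
    omega

theorem match_iterate (k s s' : ℕ) : Match (blockStart^[k] s) (blockStart^[k] s') (palLen k) :=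
  fun _ hx => by rw [letterAt_iterate_add hx, letterAt_iterate_add hx]

/-- Matching words can be desubstituted. -/
theorem Match.desubst {i j N : ℕ} (h : Match (blockStart i) (blockStart j) N) {n : ℕ}
    (hn : ∀ y < n, blockStart (i + y) + 1 < blockStart i + N) : Match i j n := by
  induction n with
  | zero => intro x hx; omega
  | succ n ih =>
    have h1 : Match i j n := ih fun y hy => hn y (by omega)
    intro x hx
    rcases Nat.lt_succ_iff_lt_or_eq.mp hx with hx | rfl
    · exact h1 x hx
    · have h2 := h1.blockStart_add le_rfl
      have h3 := hn x (by omega)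
      have h4 := blockStart_strictMono.monotone (Nat.le_add_right i x)
      -- The letters matched so far align the two block starts; the position just after the block
      -- start still lies in the common word and determines the next letter.
      have h5 := h (blockStart (i + x) + 1 - blockStart i) (by omega)
      rw [show blockStart i + (blockStart (i + x) + 1 - blockStart i) = blockStart (i + x) + 1 by
          omega,
        show blockStart j + (blockStart (i + x) + 1 - blockStart i) = blockStart (j + x) + 1 by
          omega, letterAt_blockStart_add_one, letterAt_blockStart_add_one] at h5
      exact next_injective h5

theorem le_blockStart (i : ℕ) : i ≤ blockStart i := blockStart_strictMono.le_apply

theorem blockStart_add_le (i x : ℕ) : blockStart i + x ≤ blockStart (i + x) := by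
  induction x with
  | zero => simp
  | succ x ih =>
    have := blockStart_strictMono (Nat.lt_succ_self (i + x))
    rw [← add_assoc, ← add_assoc]
    simp only [Nat.succ_eq_add_one] at this
    omega

/-- Every repetition extends to a repetition of a palindromic prefix. -/
theorem Match.exists_iterate {p q N : ℕ} (hpq : p < q) (h : Match p q N) :
    ∃ k s s', s < s' ∧ blockStart^[k] s' + p = blockStart^[k] s + q ∧ blockStart^[k] s ≤ p ∧
      p + N ≤ blockStart^[k] s + palLen k := by
  induction hM : p + N using Nat.strong_induction_on generalizing p q N with
  | _ M ih =>
    rcases Nat.eq_zero_or_pos N with rfl | hN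
    · exact ⟨0, p, q, hpq, by simp [add_comm], le_rfl, by simpa using hM.symm.le⟩
    -- extend to the left so that both words start at block starts
    have h0 := h 0 hN
    simp only [add_zero] at h0
    obtain ⟨i, j, ε, hp, hq, hm, hε⟩ : ∃ i j ε, p = blockStart i + ε ∧ q = blockStart j + ε ∧
        Match (blockStart i) (blockStart j) (N + ε) ∧ (ε = 0 ∨ ε = 1) := by
      by_cases ha : letterAt p = .a
      · obtain ⟨i, rfl⟩ := eq_blockStart_of_letterAt_eq_a ha
        obtain ⟨j, rfl⟩ := eq_blockStart_of_letterAt_eq_a (h0 ▸ ha)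
        exact ⟨i, j, 0, rfl, rfl, h, Or.inl rfl⟩
      · obtain ⟨i, rfl, -⟩ := exists_blockStart_of_letterAt_ne_a ha
        obtain ⟨j, rfl, -⟩ := exists_blockStart_of_letterAt_ne_a (h0 ▸ ha)
        refine ⟨i, j, 1, rfl, rfl, ?_, Or.inr rfl⟩
        intro x hx
        rcases x with _ | x
        · simp [letterAt_blockStart]
        · have := h x (by omega)
          rwa [add_assoc, add_assoc, add_comm 1 x] at this
    have hij : i < j := blockStart_strictMono.lt_iff_lt.mp (by omega)
    -- The least such `x` is the number of letters recovered. The word extends at most one letter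
    -- past the start of block `i + n`, and the final `a` of `pal (k + 1)` covers that letter.
    have hex : ∃ x, blockStart i + (N + ε) ≤ blockStart (i + x) + 1 :=
      ⟨N + ε, by have := blockStart_add_le i (N + ε); omega⟩
    classical
    obtain ⟨n, hn, hmin⟩ : ∃ n, blockStart i + (N + ε) ≤ blockStart (i + n) + 1 ∧
        ∀ y < n, blockStart (i + y) + 1 < blockStart i + (N + ε) :=
      ⟨Nat.find hex, Nat.find_spec hex, fun y hy => by have := Nat.find_min hex hy; omega⟩
    have hnN : n < N + ε := by
      by_contra hcon
      have h1 := hmin (N + ε - 1) (by omega)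
      have h2 := blockStart_add_le i (N + ε - 1)
      omega
    -- With `hnN` this gives `i + n < p + N`, so the induction hypothesis applies to the preimage.
    have hip := le_blockStart i
    obtain ⟨k, s, s', hs, hL, hsp, hspN⟩ := ih (i + n) (by omega) hij (hm.desubst hmin) rfl
    have hmk := match_iterate k s s'
    have h1 := hmk.blockStart_add (y := i - blockStart^[k] s) (by omega)
    rw [show blockStart^[k] s + (i - blockStart^[k] s) = i by omega,
      show blockStart^[k] s' + (i - blockStart^[k] s) = j by omega] at h1
    refine ⟨k + 1, s, s', hs, ?_, ?_, ?_⟩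
    · rw [Function.iterate_succ_apply', Function.iterate_succ_apply']
      omega
    · rw [Function.iterate_succ_apply']
      have := blockStart_strictMono.monotone hsp
      omega
    · rw [iterate_blockStart_add_palLen_succ]
      have := blockStart_strictMono.monotone hspN
      omega

/-! ### Cubes -/

/-- The last inequality is the one that limits repetitions; the third is there to carry it through
the induction. -/
theorem imageLen_bounds (k : ℕ) :
    imageLen k .c ≤ imageLen k .b ∧ imageLen k .b ≤ imageLen k .a ∧
      2 * imageLen k .b ≤ imageLen k .a + 2 * imageLen k .c ∧ palLen k < 2 * imageLen k .b := by
  induction k with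
  | zero => simp [imageLen]
  | succ k ih =>
    have := imageLen_a k
    simp only [imageLen, palLen_succ]
    omega

theorem palLen_lt_two_mul_t (k : ℕ) : palLen k < 2 * t k := by
  have := imageLen_bounds k
  rw [imageLen_a] at this
  omega

theorem palLen_strictMono : StrictMono palLen :=
  strictMono_nat_of_lt_succ fun k => by have := t_pos k; rw [palLen_succ]; omega

theorem letterAt_succ_of_eq_c {s : ℕ} (h : letterAt s = .c) : letterAt (s + 1) = .a := by
  obtain ⟨i, rfl, hi⟩ := exists_blockStart_of_letterAt_ne_a (p := s) (by rw [h]; decide)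
  have : blockStart i + 1 + 1 = blockStart (i + 1) := by
    rw [blockStart_succ]
    rcases hx : letterAt i with _ | _ | _ <;> simp_all [sigma]
  rw [this, letterAt_blockStart]

/-- A repetition of exponent at least three comes from a letter `c`. -/
theorem Match.exists_c {p L N : ℕ} (hL : 0 < L) (hN : 2 * L ≤ N) (h : Match p (p + L) N) :
    ∃ k s, letterAt s = .c ∧ L = t k ∧ blockStart^[k + 1] s ≤ p ∧
      p + N ≤ blockStart^[k + 1] s + palLen (k + 1) := by
  obtain ⟨k, s, s', hs, h1, h2, h3⟩ := h.exists_iterate (by omega)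
  have hb := imageLen_bounds k
  have hstep := iterate_blockStart_succ k s
  have hmono := (iterate_blockStart_strictMono k).monotone
  have h4 := hmono (Nat.succ_le_of_lt hs)
  rw [Nat.succ_eq_add_one] at h4
  -- For `a` or `b` the period would be at least |σ^k(b)|, against `2 * L ≤ N ≤ palLen k < 2 *
  -- imageLen k .b`.
  have hc : letterAt s = .c := by
    rcases hx : letterAt s with _ | _ | _
    · rw [hx] at hstep; omega
    · rw [hx] at hstep; omega
    · rfl
  -- Otherwise the period would span the images of `c` and of the `a` after it, which is too long
  -- for the same reason.
  have hs' : s' = s + 1 := by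
    by_contra hne
    have h5 := hmono (show s + 1 + 1 ≤ s' by omega)
    have h6 := iterate_blockStart_succ k (s + 1)
    rw [letterAt_succ_of_eq_c hc] at h6
    omega
  obtain ⟨k, rfl⟩ : ∃ j, k = j + 1 := by
    rcases k with _ | k
    · simp only [palLen_zero] at h3; omega
    · exact ⟨k, rfl⟩
  refine ⟨k, s, hc, ?_, h2, h3⟩
  rw [hs', hstep, hc, imageLen_c] at h1
  omega

theorem match_of_c {k s p N : ℕ} (hs : letterAt s = .c) (h1 : blockStart^[k + 1] s ≤ p)
    (h2 : p + N ≤ blockStart^[k + 1] s + palLen (k + 1)) : Match p (p + t k) N := by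
  intro x hx
  have h3 := match_iterate (k + 1) s (s + 1) (p + x - blockStart^[k + 1] s) (by omega)
  rw [iterate_blockStart_succ, hs, imageLen_c] at h3
  rwa [show blockStart^[k + 1] s + (p + x - blockStart^[k + 1] s) = p + x by omega,
    show blockStart^[k + 1] s + t k + (p + x - blockStart^[k + 1] s) = p + t k + x by omega] at h3

/-- The root of a cube is primitive. -/
theorem Match.not_match_of_lt {p L e : ℕ} (h : Match p (p + L) (2 * L)) (he : 0 < e) (heL : e < L) :
    ¬ Match p (p + e) L := by
  intro h1
  -- The period `L` transports a root at offset `e` to the next root, so the period `e` holds over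
  -- length `2 * L`.
  have h2 : Match p (p + e) (2 * L) := by
    intro x hx
    rcases lt_or_ge x L with hxL | hxL
    · exact h1 x hxL
    · have a1 := h (x - L) (by omega)
      have a2 := h1 (x - L) (by omega)
      have a3 := h (e + (x - L)) (by omega)
      rw [show p + L + (x - L) = p + x by omega] at a1
      rw [show p + L + (e + (x - L)) = p + e + x by omega,
        show p + (e + (x - L)) = p + e + (x - L) by omega] at a3
      rw [← a1, a2, a3]
  -- Both periods are now Tribonacci numbers, and `2 * L ≤ palLen (k' + 1) ≤ palLen k < 2 * t k = 2
  -- * L` is absurd.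
  obtain ⟨k, s, -, hk, -, -⟩ := h.exists_c (by omega) le_rfl
  obtain ⟨k', s', -, hk', h3, h4⟩ := h2.exists_c he (by omega)
  have hkk : k' < k := t_strictMono.lt_iff_lt.mp (by omega)
  have := palLen_strictMono.monotone (Nat.succ_le_of_lt hkk)
  have := palLen_lt_two_mul_t k
  simp only [Nat.succ_eq_add_one] at *
  omega

/-! ### Cubes as pairs (ω, p) and as periods -/

theorem suffix_pre_iff {w : List Letter} {e : ℕ} :
    w <:+ pre e ↔ w.length ≤ e ∧
      ∀ x (h : x < w.length), w[x] = letterAt (e - w.length + x) := by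
  constructor
  · intro h
    refine ⟨by simpa using h.length_le, fun x hx => ?_⟩
    obtain ⟨u, hu⟩ := h
    have hlen : u.length + w.length = e := by simpa using congrArg List.length hu
    have hlt : u.length + x < (pre e).length := by rw [pre_length]; omega
    rw [show e - w.length + x = u.length + x by omega, ← pre_getElem hlt]
    simp [← hu]
  · rintro ⟨h1, h2⟩
    rw [List.suffix_iff_eq_drop, pre_length]
    apply List.ext_getElem
    · simp; omega
    · intro i hi _
      rw [h2 i hi, List.getElem_drop, pre_getElem]

theorem suffix_pre_drop {n L e : ℕ} (hL : L ≤ n) :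
    (pre n).drop (n - L) <:+ pre e ↔ L ≤ e ∧ Match (n - L) (e - L) L := by
  have hlen : ((pre n).drop (n - L)).length = L := by simp; omega
  rw [suffix_pre_iff]
  simp only [hlen, List.getElem_drop, pre_getElem]
  rfl

open Classical in
/-- The periods of the cubes that end at position `n`. -/
noncomputable def cubePeriods (n : ℕ) : Finset ℕ :=
  (Finset.range (n + 1)).filter fun L =>
    0 < L ∧ 3 * L ≤ n ∧ Match (n - 3 * L) (n - 3 * L + L) (2 * L)

theorem mem_cubePeriods {n L : ℕ} : L ∈ cubePeriods n ↔
    0 < L ∧ 3 * L ≤ n ∧ Match (n - 3 * L) (n - 3 * L + L) (2 * L) := by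
  simp only [cubePeriods, Finset.mem_filter, Finset.mem_range, and_iff_right_iff_imp]
  omega

theorem IsCube.suffixes {w : List Letter} {p : ℕ} (h : IsCube w p) :
    w <:+ pre (pos w p) ∧ w <:+ pre (pos w (p + 1)) ∧ w <:+ pre (pos w (p + 2)) ∧
      Nat.count (fun e => w <:+ pre e) (pos w (p + 2)) = p + 1 := by
  classical
  obtain ⟨hw, -, hp, h1, h2⟩ := h
  have hlen := List.length_pos_iff.mpr hw
  obtain ⟨p, rfl⟩ : ∃ q, p = q + 1 := ⟨p - 1, by omega⟩
  simp only [pos, Nat.add_sub_cancel, show p + 1 + 2 - 1 = p + 2 by omega] at *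
  -- `Nat.nth` takes the value `0` when the occurrence does not exist. The gap equations make the
  -- last position positive, so all three occurrences are genuine.
  have hne : Nat.nth (fun e => w <:+ pre e) (p + 2) ≠ 0 := by omega
  have h0 : ¬ w <:+ pre 0 := fun h => by have := h.length_le; rw [pre_length] at this; omega
  exact ⟨Nat.nth_mem_of_ne_zero (Nat.nth_ne_zero_anti h0 (by omega) hne),
    Nat.nth_mem_of_ne_zero (Nat.nth_ne_zero_anti h0 (by omega) hne),
    Nat.nth_mem_of_ne_zero hne, Nat.count_nth (Nat.lt_card_toFinset_of_nth_ne_zero hne)⟩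

/-- A periodic word of length 3L yields three equally spaced occurrences of its root; primitivity of
the root makes them consecutive in the numbering. -/
theorem image_length_cubesAt (n : ℕ) :
    (fun x : List Letter × ℕ => x.1.length) '' cubesAt n = cubePeriods n := by
  classical
  ext L
  simp only [Set.mem_image, Finset.mem_coe, mem_cubePeriods, Prod.exists]
  constructor
  · rintro ⟨w, p, ⟨hc, hn⟩, rfl⟩
    simp only at hc hn ⊢
    obtain ⟨s1, s2, s3, -⟩ := hc.suffixes
    obtain ⟨hw, -, hp, h1, h2⟩ := hc
    rw [suffix_pre_iff] at s1 s2 s3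
    refine ⟨List.length_pos_iff.mpr hw, by omega, fun x hx => ?_⟩
    rcases lt_or_ge x w.length with hx' | hx'
    · have a1 := s1.2 x hx'
      have a2 := s2.2 x hx'
      rw [a1] at a2
      convert a2 using 2 <;> omega
    · have a1 := s2.2 (x - w.length) (by omega)
      have a2 := s3.2 (x - w.length) (by omega)
      rw [a1] at a2
      convert a2 using 2 <;> omega
  · rintro ⟨hL, h3L, hm⟩
    set w := (pre n).drop (n - L) with hw
    have hlen : w.length = L := by simp [hw]; omega
    have hocc : ∀ e, w <:+ pre e ↔ L ≤ e ∧ Match (n - L) (e - L) L := fun e =>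
      suffix_pre_drop (by omega)
    have o3 : w <:+ pre n := List.drop_suffix _ _
    have o2 : w <:+ pre (n - L) := by
      rw [hocc]
      refine ⟨by omega, fun x hx => ?_⟩
      have := hm (L + x) (by omega)
      rw [eq_comm]
      convert this using 2 <;> omega
    have o1 : w <:+ pre (n - 2 * L) := by
      rw [hocc] at o2 ⊢
      refine ⟨by omega, fun x hx => ?_⟩
      have a1 := hm x (by omega)
      rw [o2.2 x hx, eq_comm]
      convert a1 using 2 <;> omega
    -- An occurrence strictly in between would place the root at a proper offset inside the cube,
    -- against `Match.not_match_of_lt`.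
    have gap : ∀ e, n - 2 * L ≤ e → e < n → w <:+ pre e → e = n - 2 * L ∨ e = n - L := by
      intro e he1 he2 ho
      by_contra hne
      rw [not_or] at hne
      rw [hocc] at ho o1
      have h1 : ∀ x < L, letterAt (n - 3 * L + x) = letterAt (e - L + x) := by
        intro x hx
        rw [← ho.2 x hx, o1.2 x hx]
        congr 1; omega
      rcases lt_or_gt_of_ne hne.2 with hlt | hgt
      · refine hm.not_match_of_lt (e := e - (n - 2 * L)) (by omega) (by omega) fun x hx => ?_
        rw [h1 x hx]; congr 1; omega
      · refine hm.not_match_of_lt (e := e - (n - L)) (by omega) (by omega) fun x hx => ?_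
        rw [h1 x hx]
        have a1 := hm (e - (n - L) + x) (by omega)
        rw [← add_assoc] at a1
        rw [a1]; congr 1; omega
    set P : ℕ → Prop := fun e => w <:+ pre e with hP
    have count_gap : ∀ e e', e < e' → P e → (∀ f, e < f → f < e' → ¬ P f) →
        Nat.count P e' = Nat.count P e + 1 := by
      intro e e' hlt he hno
      obtain ⟨r, rfl⟩ : ∃ r, e' = e + 1 + r := ⟨e' - e - 1, by omega⟩
      rw [Nat.count_add, Nat.count_succ, if_pos he, Nat.add_eq_left]
      rw [Nat.count_eq_card_filter_range, Finset.card_eq_zero, Finset.filter_eq_empty_iff]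
      intro x hx
      rw [Finset.mem_range] at hx
      exact hno _ (by omega) (by omega)
    have c2 : Nat.count P (n - L) = Nat.count P (n - 2 * L) + 1 :=
      count_gap _ _ (by omega) o1 fun f h1 h2 ho => by
        have := gap f (by omega) (by omega) ho; omega
    have c3 : Nat.count P n = Nat.count P (n - 2 * L) + 2 := by
      rw [count_gap (n - L) n (by omega) o2 fun f h1 h2 ho => by
        have := gap f (by omega) (by omega) ho; omega, c2]
    have p1 : pos w (Nat.count P (n - 2 * L) + 1) = n - 2 * L := Nat.nth_count o1
    have p2 : pos w (Nat.count P (n - 2 * L) + 2) = n - L := by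
      have := Nat.nth_count (p := P) o2
      rwa [c2] at this
    have p3 : pos w (Nat.count P (n - 2 * L) + 3) = n := by
      have := Nat.nth_count (p := P) o3
      rwa [c3] at this
    refine ⟨w, Nat.count P (n - 2 * L) + 1, ⟨⟨?_, ⟨n, o3⟩, Nat.le_add_left _ _, ?_, ?_⟩, p3⟩, hlen⟩
    · exact List.length_pos_iff.mp (by rw [hlen]; exact hL)
    · simp only [add_assoc, Nat.reduceAdd]; rw [p2, p1, hlen]; omega
    · simp only [add_assoc, Nat.reduceAdd]; rw [p3, p2, hlen]; omega

/-- The length and the end position determine ω as a suffix of the prefix, and counting earlier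
occurrences of ω determines `p`. -/
theorem injOn_length_cubesAt (n : ℕ) :
    Set.InjOn (fun x : List Letter × ℕ => x.1.length) (cubesAt n) := by
  rintro ⟨w, p⟩ ⟨hc, hn⟩ ⟨w', p'⟩ ⟨hc', hn'⟩ hlen
  simp only at hc hn hc' hn' hlen
  obtain ⟨-, -, s, hp⟩ := hc.suffixes
  obtain ⟨-, -, s', hp'⟩ := hc'.suffixes
  rw [hn] at s hp
  rw [hn'] at s' hp'
  obtain rfl : w = w' := by
    rw [List.suffix_iff_eq_drop] at s s'
    rw [s, s', hlen]
  rw [hp, Nat.add_right_cancel_iff] at hp'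
  rw [hp']

theorem cubesAt_finite (n : ℕ) : (cubesAt n).Finite :=
  Set.Finite.of_finite_image (by rw [image_length_cubesAt]; exact Finset.finite_toSet _)
    (injOn_length_cubesAt n)

theorem d_eq_card (n : ℕ) : d n = (cubePeriods n).card := by
  rw [d, ← (injOn_length_cubesAt n).ncard_image, image_length_cubesAt,
    Set.ncard_coe_finset]

theorem cubesIn_zero : cubesIn 0 = ∅ := by
  rw [Set.eq_empty_iff_forall_notMem]
  rintro ⟨w, p⟩ ⟨hc, hn⟩
  simp only at hc hn
  obtain ⟨hw, -, -, h1, h2⟩ := hc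
  have := List.length_pos_iff.mpr hw
  omega

theorem cubesIn_succ (n : ℕ) : cubesIn (n + 1) = cubesIn n ∪ cubesAt (n + 1) := by
  ext x
  simp only [cubesIn, cubesAt, Set.mem_union, Set.mem_ofPred_eq, ← and_or_left]
  exact and_congr_right fun _ => by omega

theorem cubesIn_finite (n : ℕ) : (cubesIn n).Finite := by
  induction n with
  | zero => rw [cubesIn_zero]; exact Set.finite_empty
  | succ n ih => rw [cubesIn_succ]; exact ih.union (cubesAt_finite _)

theorem D_zero : D 0 = 0 := by simp [D, cubesIn_zero]

theorem D_succ (n : ℕ) : D (n + 1) = D n + d (n + 1) := by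
  rw [D, cubesIn_succ, Set.ncard_union_eq _ (cubesIn_finite n) (cubesAt_finite _)]
  · rfl
  · rw [Set.disjoint_left]
    rintro x ⟨-, h1⟩ ⟨-, h2⟩
    omega

theorem D_eq_sum (n : ℕ) : D n = ∑ i ∈ Finset.Icc 1 n, d i := by
  induction n with
  | zero => simp [D_zero]
  | succ n ih => rw [D_succ, ih, Finset.sum_Icc_succ_top (by omega)]

/-! ### The kernel words -/

theorem three_le_of_letterAt_eq_c {s : ℕ} (h : letterAt s = .c) : 3 ≤ s := by
  by_contra hcon
  have : s = 0 ∨ s = 1 ∨ s = 2 := by omega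
  rcases this with rfl | rfl | rfl <;> revert h <;> decide

/-- A palindromic prefix surrounded by the letter that follows it in `𝕋` comes from `aa`. -/
theorem Match.exists_aa {k q : ℕ} (h : Match (q + 1) 0 (palLen k + 1))
    (hq : letterAt q = next^[k] .a) :
    ∃ s, q + 1 = blockStart^[k] (s + 1) ∧ letterAt s = .a ∧ letterAt (s + 1) = .a := by
  induction k generalizing q with
  | zero =>
    refine ⟨q, rfl, hq, ?_⟩
    have := h 0 (by simp)
    exact this
  | succ k ih =>
    have h0 := h 0 (by omega)
    obtain ⟨i, hi⟩ := eq_blockStart_of_letterAt_eq_a (p := q + 1) h0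
    obtain ⟨i, rfl⟩ : ∃ j, i = j + 1 := by
      rcases i with _ | i
      · simp at hi
      · exact ⟨i, rfl⟩
    have hm : Match (blockStart 0) (blockStart (i + 1)) (palLen (k + 1) + 1) := by
      intro x hx
      rw [← hi, h x hx, blockStart_zero]
    have hm' : Match (i + 1) 0 (palLen k + 1) := by
      intro x hx
      refine (hm.desubst (n := palLen k + 1) (fun y hy => ?_) x hx).symm
      have := blockStart_strictMono.monotone (Nat.lt_succ_iff.mp hy)
      rw [palLen_succ_eq_blockStart, zero_add]
      simp only [blockStart_zero]
      omega
    -- The letter before a block start ends the previous image, and so determines the previous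
    -- preimage letter.
    have hq' : letterAt i = next^[k] .a := by
      have := letterAt_blockStart_succ_sub_one i
      rw [← hi, Nat.add_sub_cancel, hq, Function.iterate_succ_apply'] at this
      exact (next_injective this).symm
    obtain ⟨s, hs, h1, h2⟩ := ih hm' hq'
    exact ⟨s, by rw [hi, hs, Function.iterate_succ_apply'], h1, h2⟩

theorem six_le_of_aa {s : ℕ} (h : letterAt s = .a) (h' : letterAt (s + 1) = .a) : 6 ≤ s := by
  by_contra hcon
  have : s = 0 ∨ s = 1 ∨ s = 2 ∨ s = 3 ∨ s = 4 ∨ s = 5 := by omega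
  rcases this with rfl | rfl | rfl | rfl | rfl | rfl <;> revert h h' <;> decide

theorem palLen_add_three (k : ℕ) : palLen (k + 3) = palLen k + t (k + 3) := by
  rw [palLen_succ, palLen_succ, palLen_succ, t_add_three]; omega

/-- This converts the half-integral Tribonacci expressions of the statement into lengths of
palindromic prefixes. -/
theorem two_mul_palLen (k : ℕ) : 2 * palLen (k + 1) + 3 = t (k + 2) + t k := by
  induction k with
  | zero => decide
  | succ k ih =>
    have := palLen_succ (k + 1)
    have := t_add_three k
    show 2 * palLen (k + 2) + 3 = t (k + 3) + t (k + 1)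
    simp only [Nat.add_assoc, Nat.reduceAdd] at *
    omega

theorem kerNum_add_four (k : ℕ) : kerNum (k + 4) = palLen k + 2 := by
  induction k using Nat.strong_induction_on with
  | _ k ih =>
    match k with
    | 0 => decide
    | 1 => decide
    | 2 => decide
    | k + 3 =>
      have h1 := ih k (by omega)
      have h2 := ih (k + 1) (by omega)
      have h3 := ih (k + 2) (by omega)
      have e1 := palLen_succ k
      have e2 := palLen_succ (k + 1)
      have e3 := palLen_succ (k + 2)
      have e4 := two_mul_palLen k
      have : kerNum (k + 3 + 4) = kerNum (k + 2 + 4) + kerNum (k + 1 + 4) + kerNum (k + 4) - 1 := rfl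
      simp only [Nat.add_assoc, Nat.reduceAdd] at *
      omega

theorem palLen_lt_t_succ (k : ℕ) : palLen k < t (k + 1) := by
  have h := two_mul_palLen k
  have h1 := palLen_succ k
  have h2 := imageLen_bounds k
  have h3 := iterate_blockStart_t k 1
  have h4 := iterate_blockStart_succ k 1
  have h5 := iterate_blockStart_succ k 0
  rw [t_one] at h3
  rw [imageLen_a] at h2
  have e0 : letterAt 0 = .a := rfl
  have e1 : letterAt 1 = .b := rfl
  rw [e1] at h4
  rw [e0, imageLen_a, iterate_blockStart_zero] at h5
  simp only [Nat.reduceAdd, zero_add] at h3 h4 h5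
  rw [Nat.add_comm 1 k] at h3
  omega

/-- By `letterAt_palLen` the last letter of the tail is also `next^[k] .a`, so the kernel word is
`pal k` framed by the letter that follows it. -/
theorem kerWord_add_four (k : ℕ) :
    kerWord (k + 4) = next^[k] .a :: pre (palLen k + 1) := by
  have h1 : (word (k + 3)).getLastD .a = next^[k] .a := by
    have hlt : t (k + 3) - 1 < t (k + 3) := by have := t_pos (k + 3); omega
    have hne : word (k + 3) ≠ [] := List.length_pos_iff.mp (t_pos (k + 3))
    rw [List.getLastD_eq_getLast?, List.getLast?_eq_some_getLast hne, Option.getD_some,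
      List.getLast_eq_getElem]
    have := word_getElem_eq hlt
    rw [letterAt_t_sub_one, Function.iterate_add_apply] at this
    exact this
  have h2 : (word (k + 1)).take (kerNum (k + 4) - 1) = pre (palLen k + 1) := by
    rw [kerNum_add_four, ← pre_t]
    exact (List.prefix_iff_eq_take.mp (pre_prefix (palLen_lt_t_succ k))).symm ▸ by simp
  rw [kerWord, h1, h2]

theorem suffix_kerWord_iff {k e : ℕ} :
    kerWord (k + 4) <:+ pre e ↔ ∃ q, e = q + palLen k + 2 ∧ letterAt q = next^[k] .a ∧
      Match (q + 1) 0 (palLen k + 1) := by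
  rw [kerWord_add_four, suffix_pre_iff]
  simp only [List.length_cons, pre_length]
  constructor
  · rintro ⟨h1, h2⟩
    refine ⟨e - (palLen k + 2), by omega, ?_, fun x hx => ?_⟩
    · exact (h2 0 (by omega)).symm
    · have := h2 (x + 1) (by omega)
      rw [List.getElem_cons_succ, pre_getElem] at this
      rw [zero_add, this]; congr 1; omega
  · rintro ⟨q, rfl, h1, h2⟩
    refine ⟨by omega, fun x hx => ?_⟩
    rcases x with _ | x
    · rw [List.getElem_cons_zero, ← h1]; congr 1; omega
    · rw [List.getElem_cons_succ, pre_getElem]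
      have := h2 x (by omega)
      rw [zero_add] at this
      rw [← this]; congr 1; omega

/-- The first `aa` occupies positions `6` and `7 = t 3`. The `k`-th image of the second `a` starts
at `t (k + 3)`, where the first framed copy of `pal k` begins. -/
theorem pos_kerWord (k : ℕ) : pos (kerWord (k + 4)) 1 = palLen (k + 3) + 1 := by
  have hmem : kerWord (k + 4) <:+ pre (palLen (k + 3) + 1) := by
    rw [suffix_kerWord_iff]
    have htp := t_pos (k + 3)
    refine ⟨t (k + 3) - 1, by rw [palLen_add_three]; omega, ?_, ?_⟩
    · rw [letterAt_t_sub_one, Function.iterate_add_apply]; rfl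
    · rw [Nat.sub_add_cancel htp]
      intro x hx
      rcases Nat.lt_succ_iff_lt_or_eq.mp hx with hx | rfl
      · have := match_iterate k 7 0 x hx
        rw [iterate_blockStart_zero, show (7 : ℕ) = t 3 from rfl, iterate_blockStart_t,
          Nat.add_comm 3 k] at this
        exact this
      · rw [add_comm, ← palLen_add_three, letterAt_palLen, zero_add, letterAt_palLen,
          Function.iterate_add_apply]; rfl
  refine le_antisymm ?_ ?_
  · rw [pos, Nat.sub_self, Nat.nth_zero]
    exact Nat.sInf_le hmem
  · have h : kerWord (k + 4) <:+ pre (pos (kerWord (k + 4)) 1) := by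
      rw [pos, Nat.sub_self, Nat.nth_zero]
      exact Nat.sInf_mem (s := Set.ofPred fun e => kerWord (k + 4) <:+ pre e) ⟨_, hmem⟩
    obtain ⟨q, hq, h1, h2⟩ := suffix_kerWord_iff.mp h
    obtain ⟨s, hs, h3, h4⟩ := h2.exists_aa h1
    have h5 := (iterate_blockStart_strictMono k).monotone
      (show t 3 ≤ s + 1 from Nat.succ_le_succ (six_le_of_aa h3 h4))
    rw [iterate_blockStart_t, Nat.add_comm 3 k] at h5
    rw [hq, palLen_add_three]
    omega

/-! ### The recursion for `d` -/

/-- Position `3` carries the first `c`, and `4 = t 2`; this locates the first run of period `t k`.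
-/
theorem iterate_blockStart_three (k : ℕ) : blockStart^[k + 1] 3 + t k = t (k + 3) := by
  have h : blockStart^[k + 1] 4 = _ := iterate_blockStart_succ (k + 1) 3
  have h' := iterate_blockStart_t (k + 1) 2
  rw [show letterAt 3 = .c from rfl, imageLen_c] at h
  rw [show 2 + (k + 1) = k + 3 by omega, t_two] at h'
  omega

theorem exists_c_of_mem_cubePeriods {n L : ℕ} (h : L ∈ cubePeriods n) :
    ∃ k s, letterAt s = .c ∧ L = t k ∧ blockStart^[k + 1] s + 3 * t k ≤ n ∧
      n ≤ blockStart^[k + 1] s + palLen (k + 1) + t k ∧ t (k + 3) ≤ blockStart^[k + 1] s + t k := by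
  obtain ⟨hL, h3, hm⟩ := mem_cubePeriods.mp h
  obtain ⟨k, s, hs, rfl, h1, h2⟩ := hm.exists_c hL le_rfl
  have h4 := (iterate_blockStart_strictMono (k + 1)).monotone (three_le_of_letterAt_eq_c hs)
  have h5 := iterate_blockStart_three k
  exact ⟨k, s, hs, rfl, by omega, by omega, by omega⟩

/-- A run of period t_k contains a cube only if `2 * t k ≤ palLen (k + 1)`, which fails for `k ≤ 2`.
For `k ≥ 3` a cube ends no earlier than `t 6 + 2 * t 3 = 58`. -/
theorem d_eq_zero_of_lt {n : ℕ} (hn : n < 58) : d n = 0 := by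
  rw [d_eq_card, Finset.card_eq_zero, Finset.eq_empty_iff_forall_notMem]
  intro L hL
  obtain ⟨k, s, -, -, h1, h2, h3⟩ := exists_c_of_mem_cubePeriods hL
  match k with
  | 0 => have : palLen 1 = 1 := rfl; simp only [zero_add, t_zero] at *; omega
  | 1 => have : palLen 2 = 3 := rfl; simp only [Nat.reduceAdd, t_one] at *; omega
  | 2 => have : palLen 3 = 7 := rfl; simp only [Nat.reduceAdd, t_two] at *; omega
  | k + 3 =>
    have h4 := t_strictMono.monotone (show 3 ≤ k + 3 by omega)
    have h5 := t_strictMono.monotone (show 6 ≤ k + 3 + 3 by omega)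
    have : t 3 = 7 := rfl
    have : t 6 = 44 := rfl
    omega

/-- Since `pal (j + 4)` is T_{j+3} followed by `pal (j + 3)`, this prefix has period `t (j + 3)`;
cubes starting at or after that position can be translated back. -/
theorem mem_cubePeriods_sub {j n L : ℕ} (hn : n ≤ palLen (j + 4)) :
    L ∈ cubePeriods (n - t (j + 3)) ↔ L ∈ cubePeriods n ∧ t (j + 3) + 3 * L ≤ n := by
  have hper : ∀ x, t (j + 3) ≤ x → x < n → letterAt (x - t (j + 3)) = letterAt x := by
    intro x h1 h2
    have h3 : palLen (j + 4) = _ := palLen_succ (j + 3)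
    have h := match_iterate (j + 3) 0 1 (x - t (j + 3)) (by omega)
    have h4 := iterate_blockStart_t (j + 3) 0
    rw [t_zero, zero_add] at h4
    rw [h4, iterate_blockStart_zero, zero_add] at h
    rw [h]; congr 1; omega
  rw [mem_cubePeriods, mem_cubePeriods]
  constructor
  · rintro ⟨h1, h2, h3⟩
    refine ⟨⟨h1, by omega, fun x hx => ?_⟩, by omega⟩
    have h4 := h3 x hx
    rw [← hper _ (by omega) (by omega), ← hper (n - 3 * L + L + x) (by omega) (by omega)]
    convert h4 using 2 <;> omega
  · rintro ⟨⟨h1, h2, h3⟩, h5⟩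
    refine ⟨h1, by omega, fun x hx => ?_⟩
    have h4 := h3 x hx
    rw [← hper _ (by omega) (by omega), ← hper (n - 3 * L + L + x) (by omega) (by omega)] at h4
    convert h4 using 2 <;> omega

/-- These are the cubes that cannot be translated back: they start before `t (j + 3)` and end after
`palLen (j + 3)`. -/
theorem mem_cubePeriods_of_lt {j n L : ℕ} (hn : palLen (j + 3) < n) :
    L ∈ cubePeriods n ∧ n < t (j + 3) + 3 * L ↔
      L = t j ∧ t (j + 3) + 2 * t j ≤ n ∧ n ≤ palLen (j + 3) + t j := by
  have e1 := palLen_succ j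
  have e2 := palLen_succ (j + 1)
  have e3 := palLen_succ (j + 2)
  have e4 := t_add_three j
  have e5 := iterate_blockStart_three j
  simp only [Nat.add_assoc, Nat.reduceAdd] at e2 e3
  constructor
  · rintro ⟨h, hlt⟩
    obtain ⟨k, s, hs, rfl, h1, h2, h3⟩ := exists_c_of_mem_cubePeriods h
    rcases lt_trichotomy k j with hk | rfl | hk
    -- The image of this `c` ends by `t (j + 3)`, so its run ends by `t (j + 3) + palLen j = palLen
    -- (j + 3)`, before `n`.
    · exfalso
      have h4 := iterate_blockStart_t (k + 1) (j + 2 - k)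
      rw [show j + 2 - k + (k + 1) = j + 3 by omega] at h4
      have h5 : s < t (j + 2 - k) :=
        (iterate_blockStart_strictMono (k + 1)).lt_iff_lt.mp (by omega)
      have h6 := (iterate_blockStart_strictMono (k + 1)).monotone (Nat.succ_le_of_lt h5)
      rw [Nat.succ_eq_add_one, iterate_blockStart_succ, hs, imageLen_c] at h6
      have h7 := palLen_strictMono.monotone (Nat.succ_le_of_lt hk)
      rw [Nat.succ_eq_add_one] at h7
      omega
    · have h4 := iterate_blockStart_t (k + 1) 2
      rw [show 2 + (k + 1) = k + 3 by omega, t_two] at h4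
      have h5 : s < 4 := (iterate_blockStart_strictMono (k + 1)).lt_iff_lt.mp (by omega)
      have h6 := three_le_of_letterAt_eq_c hs
      obtain rfl : s = 3 := by omega
      exact ⟨rfl, by omega, by omega⟩
    -- The run starts at `t (k + 2) + t (k + 1)` or later, hence after `t (j + 3)`, too late for the
    -- cube.
    · exfalso
      have h4 := t_strictMono.monotone (show j + 3 ≤ k + 2 by omega)
      have h5 := t_add_three k
      have := t_pos (k + 1)
      omega
  · rintro ⟨rfl, h1, h2⟩
    have htp := t_pos j
    have hle := t_strictMono.monotone (show j ≤ j + 3 by omega)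
    refine ⟨mem_cubePeriods.mpr ⟨htp, by omega, ?_⟩, ?_⟩
    · exact match_of_c (s := 3) rfl (by omega) (by omega)
    · have := palLen_lt_two_mul_t j
      omega

/-- The recursion for `d` on the block that ends at the length of a palindromic prefix. -/
theorem d_eq_d_sub_add {j n : ℕ} (h1 : palLen (j + 3) < n) (h2 : n ≤ palLen (j + 4)) :
    d n = d (n - t (j + 3)) +
      if t (j + 3) + 2 * t j ≤ n ∧ n ≤ palLen (j + 3) + t j then 1 else 0 := by
  classical
  rw [d_eq_card, d_eq_card]
  have hdec : cubePeriods n = cubePeriods (n - t (j + 3)) ∪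
      (if t (j + 3) + 2 * t j ≤ n ∧ n ≤ palLen (j + 3) + t j then {t j} else ∅) := by
    ext L
    have a := mem_cubePeriods_sub (L := L) h2
    have b := mem_cubePeriods_of_lt (L := L) h1
    have hor := lt_or_ge n (t (j + 3) + 3 * L)
    rw [Finset.mem_union, a]
    split_ifs with hc
    · rw [Finset.mem_singleton]
      constructor
      · intro h
        rcases hor with h' | h'
        · exact Or.inr (b.mp ⟨h, h'⟩).1
        · exact Or.inl ⟨h, h'⟩
      · rintro (h | h)
        · exact h.1
        · exact (b.mpr ⟨h, hc⟩).1
    · simp only [Finset.notMem_empty, or_false]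
      refine ⟨fun h => ⟨h, ?_⟩, fun h => h.1⟩
      rcases hor with h' | h'
      · exact absurd (b.mp ⟨h, h'⟩).2 hc
      · exact h'
  have hdisj : Disjoint (cubePeriods (n - t (j + 3)))
      (if t (j + 3) + 2 * t j ≤ n ∧ n ≤ palLen (j + 3) + t j then {t j} else ∅) := by
    split_ifs with hc
    · rw [Finset.disjoint_singleton_right, mem_cubePeriods_sub h2]
      intro h
      have := ((mem_cubePeriods_of_lt h1).mpr ⟨rfl, hc⟩).2
      omega
    · exact Finset.disjoint_empty_right _
  rw [hdec, Finset.card_union_of_disjoint hdisj]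
  congr 1
  split_ifs <;> simp

/-! ### The blocks -/

theorem gammaMin_add_four (k : ℕ) : gammaMin (k + 4) = palLen (k + 3) + 1 := pos_kerWord k

theorem gammaMax_add_four (k : ℕ) : gammaMax (k + 4) = palLen (k + 4) := by
  have h := palLen_succ (k + 3)
  have h' := pos_kerWord k
  rw [gammaMax, h', Nat.add_sub_assoc (t_pos _), h, show k + 4 - 1 = k + 3 by omega]
  have := t_pos (k + 3)
  omega

theorem gamma_add_four (k : ℕ) :
    gamma (k + 4) 1 = List.range' (palLen (k + 3) + 1) (t (k + 3)) := by
  rw [gamma, pos_kerWord]; rfl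

theorem mem_gamma_add_four {k n : ℕ} :
    n ∈ gamma (k + 4) 1 ↔ palLen (k + 3) < n ∧ n ≤ palLen (k + 4) := by
  rw [gamma_add_four, List.mem_range'_1, palLen_succ (k + 3)]
  omega

theorem t_succ_le (k : ℕ) : t (k + 1) ≤ 2 * t k := by
  have h := blockStart_t k
  rw [← h]
  have : ∀ i, blockStart i ≤ 2 * i := by
    intro i
    induction i with
    | zero => simp
    | succ i ih => rw [blockStart_succ]; have := sigma_length_le (letterAt i); omega
  exact this _

theorem two_mul_t_le_palLen (k : ℕ) : 2 * t (k + 3) ≤ palLen (k + 4) := by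
  induction k with
  | zero => decide
  | succ k ih =>
    have h1 := t_succ_le (k + 3)
    have h2 := palLen_succ (k + 4)
    simp only [Nat.add_assoc, Nat.reduceAdd, Nat.add_comm 1 _] at *
    omega

theorem palLen_succ_lt (k : ℕ) : palLen (k + 1) + 1 ≤ 3 * t k := by
  have := palLen_succ k
  have := palLen_lt_two_mul_t k
  omega

/-- This places the first new cube end, `t (j + 3) + 2 * t j`, at offset `lead (j + 4)` in the block
starting at `palLen (j + 3) + 1`. -/
theorem lead_add_four (j : ℕ) : lead (j + 4) + palLen (j + 1) + 1 = 3 * t j := by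
  have h1 := two_mul_palLen j
  have h2 := palLen_succ_lt j
  unfold lead
  rw [show j + 4 - 4 = j by omega, show j + 4 - 2 = j + 2 by omega]
  omega

theorem ones_add_seven (j : ℕ) : ones (j + 7) + 2 * t (j + 3) = palLen (j + 4) + 1 := by
  have h1 := two_mul_palLen (j + 3)
  have h2 := two_mul_t_le_palLen j
  unfold ones
  rw [show j + 7 - 4 = j + 3 by omega, show j + 7 - 2 = j + 5 by omega]
  simp only [Nat.add_assoc, Nat.reduceAdd] at h1
  omega

/-! ### The vectors `d(Γ_m)` -/

theorem palLen_add_one_lt (j : ℕ) : palLen j + 1 < 2 * t j ∨ j = 0 := by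
  match j with
  | 0 => exact Or.inr rfl
  | 1 => exact Or.inl (by decide)
  | 2 => exact Or.inl (by decide)
  | j + 3 =>
    left
    have h1 := palLen_lt_t_succ (j + 3)
    have h2 := t_add_three j
    have h3 := t_add_three (j + 1)
    have h4 := t_pos j
    simp only [Nat.add_assoc, Nat.reduceAdd] at *
    omega

/-- The ones stop exactly where the first of the three sub-blocks stops, which is why η² and θ²
coincide. -/
theorem lead_add_ones (j : ℕ) : lead (j + 7) + ones (j + 7) = t (j + 3) := by
  have h1 : lead (j + 7) + palLen (j + 4) + 1 = _ := lead_add_four (j + 3)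
  have h2 := ones_add_seven j
  omega

theorem lead_pos (j : ℕ) : 0 < lead (j + 7) := by
  have h1 : lead (j + 7) + palLen (j + 4) + 1 = _ := lead_add_four (j + 3)
  have h2 : palLen (j + 4) = _ := palLen_succ (j + 3)
  have h3 := palLen_add_one_lt (j + 3)
  omega

theorem ones_pos (j : ℕ) : 0 < ones (j + 7) := by
  have h1 := ones_add_seven j
  have h2 := two_mul_t_le_palLen j
  omega

/-- The recursion for `d`, in coordinates relative to the block. -/
theorem d_palLen_add {j x : ℕ} (hx : x < t (j + 6)) :
    d (palLen (j + 6) + 1 + x) = d (palLen (j + 3) + 1 + x) +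
      if lead (j + 7) ≤ x ∧ x < t (j + 3) then 1 else 0 := by
  have h1 : palLen (j + 7) = _ := palLen_succ (j + 6)
  have h2 : palLen (j + 6) = _ := palLen_add_three (j + 3)
  have h3 : lead (j + 7) + palLen (j + 4) + 1 = _ := lead_add_four (j + 3)
  have h4 : palLen (j + 4) = _ := palLen_succ (j + 3)
  have h5 : t (j + 3 + 3) = t (j + 6) := rfl
  rw [d_eq_d_sub_add (j := j + 3) (by simp only [Nat.add_assoc, Nat.reduceAdd]; omega)
    (by simp only [Nat.add_assoc, Nat.reduceAdd]; omega)]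
  simp only [Nat.add_assoc, Nat.reduceAdd] at *
  exact congrArg₂ (· + ·) (congrArg d (by omega)) (if_congr (by omega) rfl rfl)

/-- Offset `0` precedes the ones, so the value is inherited from three blocks earlier, down to the
initial zeros. -/
theorem d_palLen_add_one (j : ℕ) : d (palLen j + 1) = 0 := by
  induction j using Nat.strong_induction_on with
  | _ j ih =>
    by_cases hj : j < 7
    · apply d_eq_zero_of_lt
      have := palLen_strictMono.monotone (show j ≤ 6 by omega)
      have : palLen 6 = 51 := rfl
      omega
    · obtain ⟨i, rfl⟩ : ∃ i, j = i + 6 := ⟨j - 6, by omega⟩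
      have h := d_palLen_add (j := i) (x := 0) (t_pos _)
      have := lead_pos i
      rw [if_neg (by omega)] at h
      rw [← add_zero (palLen (i + 6) + 1), h]
      exact ih (i + 3) (by omega)

theorem dGamma_add_four (k : ℕ) :
    dGamma (k + 4) = (List.range' (palLen (k + 3) + 1) (t (k + 3))).map d := by
  rw [dGamma, gamma_add_four]

/-- Keeping the translated interval unsplit lets the same formula produce the three initial vectors,
where part of that interval lies before Γ_7. -/
theorem dGamma_add_seven (j : ℕ) :
    dGamma (j + 7) = vadd ((List.range' (palLen (j + 3) + 1) (t (j + 6))).map d)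
      (rep (lead (j + 7)) 0 ++ rep (ones (j + 7)) 1 ++ rep (t (j + 5) + t (j + 4)) 0) := by
  have hlo := lead_add_ones j
  have ht : t (j + 6) = _ := t_add_three (j + 3)
  rw [dGamma_add_four (j + 3)]
  simp only [Nat.add_assoc, Nat.reduceAdd] at ht ⊢
  apply List.ext_getElem
  · simp [vadd]; omega
  · intro x h1 h2
    have hx : x < t (j + 6) := by simpa using h1
    have := d_palLen_add hx
    simp only [vadd, rep, List.getElem_zipWith, List.getElem_map, List.getElem_range', one_mul,
      List.getElem_append, List.getElem_replicate, List.length_append, List.length_replicate]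
    rw [this]
    refine congrArg₂ (· + ·) rfl ?_
    split_ifs <;> omega

theorem dGamma_rec (i : ℕ) :
    dGamma (i + 10) = vadd (dGamma (i + 7) ++ dGamma (i + 8) ++ dGamma (i + 9))
      (rep (lead (i + 10)) 0 ++ rep (ones (i + 10)) 1 ++ rep (t (i + 8) + t (i + 7)) 0) := by
  have h := dGamma_add_seven (i + 3)
  have h6 : palLen (i + 7) = palLen (i + 6) + t (i + 6) := palLen_succ (i + 6)
  have h7 : palLen (i + 8) = palLen (i + 7) + t (i + 7) := palLen_succ (i + 7)
  have ht : t (i + 9) = t (i + 8) + t (i + 7) + t (i + 6) := t_add_three (i + 6)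
  simp only [Nat.add_assoc, Nat.reduceAdd] at h
  have e : (List.range' (palLen (i + 6) + 1) (t (i + 9))).map d =
      dGamma (i + 7) ++ dGamma (i + 8) ++ dGamma (i + 9) := by
    rw [dGamma_add_four (i + 3), dGamma_add_four (i + 4), dGamma_add_four (i + 5)]
    simp only [Nat.add_assoc, Nat.reduceAdd]
    rw [← List.map_append, ← List.map_append, h7, h6,
      show palLen (i + 6) + t (i + 6) + 1 = palLen (i + 6) + 1 + t (i + 6) by omega,
      show palLen (i + 6) + t (i + 6) + t (i + 7) + 1 =
        palLen (i + 6) + 1 + t (i + 6) + t (i + 7) by omega,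
      show t (i + 9) = t (i + 6) + (t (i + 7) + t (i + 8)) by omega,
      ← List.range'_append_1, ← List.range'_append_1, List.append_assoc]
  rw [h, e]

theorem map_d_eq_replicate {a r : ℕ} (h : a + r ≤ 58) :
    (List.range' a r).map d = rep r 0 := by
  rw [List.eq_replicate_iff]
  refine ⟨by simp, fun b hb => ?_⟩
  obtain ⟨x, hx, rfl⟩ := List.mem_map.mp hb
  rw [List.mem_range'_1] at hx
  exact d_eq_zero_of_lt (by omega)

theorem dGamma_seven : dGamma 7 = rep 6 0 ++ [1] ++ rep 37 0 := by
  rw [dGamma_add_seven 0, map_d_eq_replicate (by decide)]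
  decide +kernel

theorem dGamma_eight : dGamma 8 = rep 11 0 ++ [1, 1] ++ rep 30 0 ++ [1] ++ rep 37 0 := by
  rw [dGamma_add_seven 1]
  have h : (List.range' (palLen 4 + 1) (t 7)).map d = rep 37 0 ++ dGamma 7 := by
    rw [dGamma_add_four 3, ← map_d_eq_replicate (a := palLen 4 + 1) (r := 37) (by decide),
      ← List.map_append]
    exact congrArg (List.map d) (by decide +kernel)
  rw [h, dGamma_seven]
  decide +kernel

theorem dGamma_nine : dGamma 9 = rep 20 0 ++ rep 4 1 ++ rep 6 0 ++ [1] ++ rep 48 0 ++ [1, 1] ++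
    rep 30 0 ++ [1] ++ rep 37 0 := by
  rw [dGamma_add_seven 2]
  have h : (List.range' (palLen 5 + 1) (t 8)).map d = rep 24 0 ++ dGamma 7 ++ dGamma 8 := by
    rw [dGamma_add_four 3, dGamma_add_four 4,
      ← map_d_eq_replicate (a := palLen 5 + 1) (r := 24) (by decide),
      ← List.map_append, ← List.map_append]
    exact congrArg (List.map d) (by decide +kernel)
  rw [h, dGamma_seven, dGamma_eight]
  decide +kernel

/-! ### Sums -/

theorem D_add_sum_Icc {a n : ℕ} (h : a ≤ n) : D a + ∑ i ∈ Finset.Icc (a + 1) n, d i = D n := by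
  induction n, h using Nat.le_induction with
  | base => simp
  | succ n hn ih => rw [Finset.sum_Icc_succ_top (by omega), ← add_assoc, ih, D_succ]

theorem D_add_sum_range' (a r : ℕ) : D a + ((List.range' (a + 1) r).map d).sum = D (a + r) := by
  induction r with
  | zero => simp
  | succ r ih =>
    rw [List.range'_1_concat, List.map_append, List.sum_append, ← add_assoc, ih, ← add_assoc,
      D_succ, add_right_comm a 1 r]
    simp

theorem D_palLen_add_sum (k : ℕ) :
    D (palLen (k + 3)) + (dGamma (k + 4)).sum = D (palLen (k + 4)) := by
  rw [dGamma_add_four, D_add_sum_range', ← palLen_succ]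

theorem D_palLen_six : D (palLen 6) = 0 := by
  rw [D_eq_sum]
  apply Finset.sum_eq_zero
  intro i hi
  have : palLen 6 = 51 := rfl
  rw [Finset.mem_Icc] at hi
  exact d_eq_zero_of_lt (by omega)

/-- The recursion for the partial block sums. -/
theorem D_palLen_add (j x : ℕ) (hx : x ≤ t (j + 6)) :
    D (palLen (j + 6) + x) + D (palLen (j + 3)) =
      D (palLen (j + 6)) + D (palLen (j + 3) + x) + min (x - lead (j + 7)) (ones (j + 7)) := by
  -- The truncated expression `min (x - lead) ones` counts the ones among the first `x` entries of
  -- the indicator vector.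
  induction x with
  | zero => simp
  | succ x ih =>
    have h1 := ih (by omega)
    have h2 := d_palLen_add (j := j) (x := x) (by omega)
    have h3 := lead_add_ones j
    rw [← add_assoc, ← add_assoc, D_succ, D_succ]
    rw [add_right_comm _ 1 x, add_right_comm _ 1 x] at h2
    rw [h2]
    split_ifs <;> omega

theorem sum_dGamma_rec (i : ℕ) :
    (dGamma (i + 10)).sum =
      (dGamma (i + 7)).sum + (dGamma (i + 8)).sum + (dGamma (i + 9)).sum + ones (i + 10) := by
  have h := D_palLen_add (i + 3) (t (i + 9)) le_rfl
  have e1 := D_palLen_add_sum (i + 3)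
  have e2 := D_palLen_add_sum (i + 4)
  have e3 := D_palLen_add_sum (i + 5)
  have e4 := D_palLen_add_sum (i + 6)
  have p1 : palLen (i + 10) = _ := palLen_succ (i + 9)
  have p2 : palLen (i + 9) = _ := palLen_add_three (i + 6)
  have l := lead_add_ones (i + 3)
  have l' := t_add_three (i + 6)
  simp only [Nat.add_assoc, Nat.reduceAdd] at *
  rw [← p1, ← p2] at h
  omega

/-- Apart from a constant, the inhomogeneous term μ_m is itself a Tribonacci solution; this
resonance causes the factor m. Multiplication by `44` clears denominators. -/
theorem sum_dGamma_closed (j : ℕ) :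
    44 * ((dGamma (j + 7)).sum : ℤ) =
      2 * (j + 7) * (7 * t (j + 7) - 13 * t (j + 6) + t (j + 5)) +
        (-41 * t (j + 7) + 74 * t (j + 6) - 7 * t (j + 5)) + 11 := by
  induction j using Nat.strong_induction_on with
  | _ j ih =>
    match j with
    | 0 =>
      rw [show t (0 + 7) = 81 by decide +kernel, show t (0 + 6) = 44 by decide +kernel, show t (0 + 5) = 24 by decide +kernel,
        dGamma_seven]
      decide +kernel
    | 1 =>
      rw [show t (1 + 7) = 149 by decide +kernel, show t (1 + 6) = 81 by decide +kernel, show t (1 + 5) = 44 by decide +kernel,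
        dGamma_eight]
      decide +kernel
    | 2 =>
      rw [show t (2 + 7) = 274 by decide +kernel, show t (2 + 6) = 149 by decide +kernel,
        show t (2 + 5) = 81 by decide +kernel, dGamma_nine]
      decide +kernel
    | i + 3 =>
      have h1 := ih i (by omega)
      have h2 := ih (i + 1) (by omega)
      have h3 := ih (i + 2) (by omega)
      have h4 := sum_dGamma_rec i
      have h5 := ones_add_seven (i + 3)
      have h6 := two_mul_palLen (i + 6)
      have a5 := t_add_three (i + 5)
      have a6 := t_add_three (i + 6)
      have a7 := t_add_three (i + 7)
      simp only [Nat.add_assoc, Nat.reduceAdd] at *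
      zify at *
      rw [h4, a7, a6, a5]
      rw [a6, a5] at h3
      rw [a5] at h2 h6
      linear_combination h1 + h2 + h3 + 44 * h5 + 22 * h6

theorem D_palLen_closed (j : ℕ) :
    44 * (D (palLen (j + 7)) : ℤ) =
      (j + 7) * (9 * t (j + 7) - 12 * t (j + 6) - 5 * t (j + 5)) +
        12 * (-2 * t (j + 7) + 2 * t (j + 6) + t (j + 5)) + 11 * (j + 7) := by
  induction j with
  | zero =>
    have h : D (palLen 7) = 1 := by
      rw [← D_palLen_add_sum 3, dGamma_seven, D_palLen_six]; decide
    rw [show t (0 + 7) = 81 by decide +kernel, show t (0 + 6) = 44 by decide +kernel,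
      show t (0 + 5) = 24 by decide +kernel, zero_add, h]
    decide
  | succ j ih =>
    have h1 := D_palLen_add_sum (j + 4)
    have h2 := sum_dGamma_closed (j + 1)
    have h3 := t_add_three (j + 5)
    simp only [Nat.add_assoc, Nat.reduceAdd, Nat.add_comm 1] at *
    zify at *
    rw [← h1, h3]
    rw [h3] at h2
    linear_combination ih + h2

theorem D_palLen_eq_sum (j : ℕ) :
    D (palLen (j + 7)) = ∑ i ∈ Finset.Icc 7 (j + 7), (dGamma i).sum := by
  induction j with
  | zero => simp [← D_palLen_add_sum 3, D_palLen_six]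
  | succ j ih =>
    rw [show j + 1 + 7 = j + 7 + 1 by omega, Finset.sum_Icc_succ_top (by omega), ← ih]
    exact (D_palLen_add_sum (j + 4)).symm

/-- Every position from `52` on lies in a unique block. -/
theorem exists_palLen {n : ℕ} (hn : 52 ≤ n) :
    ∃ j, palLen (j + 6) < n ∧ n ≤ palLen (j + 7) := by
  have hex : ∃ i, n ≤ palLen i := ⟨n, palLen_strictMono.le_apply⟩
  classical
  have h1 := Nat.find_spec hex
  have h2 : 6 < Nat.find hex := by
    rw [Nat.lt_find_iff]
    intro m hm
    have := palLen_strictMono.monotone hm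
    have : palLen 6 = 51 := rfl
    omega
  have h3 := Nat.find_min hex (m := Nat.find hex - 1) (by omega)
  refine ⟨Nat.find hex - 7, ?_, ?_⟩
  · rw [show Nat.find hex - 7 + 6 = Nat.find hex - 1 by omega]; omega
  · rwa [show Nat.find hex - 7 + 7 = Nat.find hex by omega]

/-! ### The first values of `d` and `D` -/

/-- The values `d(0), …, d(325)`. -/
def dTable : List ℕ :=
  rep 52 0 ++ (rep 6 0 ++ [1] ++ rep 37 0) ++
    (rep 11 0 ++ [1, 1] ++ rep 30 0 ++ [1] ++ rep 37 0) ++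
    (rep 20 0 ++ rep 4 1 ++ rep 6 0 ++ [1] ++ rep 48 0 ++ [1, 1] ++ rep 30 0 ++ [1] ++ rep 37 0)

theorem map_d_range' : (List.range' 0 326).map d = dTable := by
  rw [dTable, ← dGamma_nine, ← dGamma_eight, ← dGamma_seven,
    ← map_d_eq_replicate (a := 0) (r := 52) (by decide), dGamma_add_four 3, dGamma_add_four 4,
    dGamma_add_four 5, ← List.map_append, ← List.map_append, ← List.map_append]
  exact congrArg (List.map d) (by decide +kernel)

theorem d_zero : d 0 = 0 := d_eq_zero_of_lt (by omega)

theorem D_eq_sum_take {n : ℕ} (hn : n < 326) : D n = (dTable.take (n + 1)).sum := by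
  have h := D_add_sum_range' 0 n
  rw [D_zero, zero_add, zero_add] at h
  rw [← map_d_range', show 326 = n + 1 + (325 - n) by omega, ← List.range'_append_1,
    List.map_append, List.take_left' (by simp), add_comm n 1, ← List.range'_append_1,
    List.map_append, List.sum_append, zero_add, h]
  simp [d_zero]

/-! ### The algorithm -/

@[simp] theorem Counted.bind_val {α β : Type} (x : Counted α) (f : α → Counted β) :
    (x >>= f).val = (f x.val).val := rfl

@[simp] theorem Counted.bind_cost {α β : Type} (x : Counted α) (f : α → Counted β) :
    (x >>= f).cost = x.cost + (f x.val).cost := rfl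

@[simp] theorem Counted.pure_val {α : Type} (x : α) : (pure x : Counted α).val = x := rfl

@[simp] theorem Counted.pure_cost {α : Type} (x : α) : (pure x : Counted α).cost = 0 := rfl

theorem cLin_val (α β γ x y z : ℤ) : (cLin α β γ x y z).val = α * x + β * y + γ * z := rfl

theorem cLin_cost (α β γ x y z : ℤ) : (cLin α β γ x y z).cost = 5 := rfl

theorem blockSum_val (m x y z : ℤ) : (blockSum m x y z).val =
    (2 * (m * (7 * x + -13 * y + 1 * z)) + 1 * (-41 * x + 74 * y + -7 * z) + 11 * 1) / 44 := rfl

theorem blockSum_cost (m x y z : ℤ) : (blockSum m x y z).cost = 17 := rfl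

theorem prefixSum_val (m x y z : ℤ) : (prefixSum m x y z).val =
    (1 * (m * (9 * x + -12 * y + -5 * z)) + 12 * (-2 * x + 2 * y + 1 * z) + 11 * m) / 44 := rfl

theorem prefixSum_cost (m x y z : ℤ) : (prefixSum m x y z).cost = 17 := rfl

theorem blockSum_eq (j : ℕ) :
    (blockSum (j + 7 : ℕ) (t (j + 7)) (t (j + 6)) (t (j + 5))).val = (dGamma (j + 7)).sum := by
  rw [blockSum_val]
  apply Int.ediv_eq_of_eq_mul_right (by norm_num)
  rw [sum_dGamma_closed]
  push_cast
  ring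

theorem prefixSum_eq (j : ℕ) :
    (prefixSum (j + 7 : ℕ) (t (j + 7)) (t (j + 6)) (t (j + 5))).val = D (palLen (j + 7)) := by
  rw [prefixSum_val]
  apply Int.ediv_eq_of_eq_mul_right (by norm_num)
  rw [D_palLen_closed]
  push_cast
  ring

theorem countUpTo_cost_le (n : ℤ) (l : List ℤ) : (countUpTo n l).cost ≤ 2 * l.length := by
  induction l with
  | nil => exact le_rfl
  | cons e l ih =>
    simp only [countUpTo, Counted.bind_cost, List.length_cons]
    split_ifs
    · simp only [cLt, Counted.pure_cost]; omega
    · simp only [cLt, cAdd]; omega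

theorem countUpTo_eq_D : ∀ n < 326,
    (countUpTo (n : ℕ) (ends 7 ++ ends 8 ++ ends 9)).val = ((dTable.take (n + 1)).sum : ℕ) := by
  decide +kernel

theorem countUpTo_ends : ∀ m < 3, ∀ n < 326, palLen (m + 6) < n → n ≤ palLen (m + 7) →
    (countUpTo (n : ℕ) (ends (m + 7))).val + ((dTable.take (palLen (m + 6) + 1)).sum : ℕ) =
      ((dTable.take (n + 1)).sum : ℕ) := by
  decide +kernel

theorem partialSum_add_seven {m : ℕ} (hm : m < 3) (x y z n : ℤ) :
    partialSum (m + 7) x y z n = countUpTo n (ends (m + 7)) := by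
  interval_cases m <;> rfl

theorem partialSum_add_ten_val {x y z n t3 t4 t5 : ℤ} (m : ℕ) (h3 : x = y + z + t3)
    (h4 : y = z + t3 + t4) (h5 : z = t3 + t4 + t5) :
    (partialSum (m + 10) x y z n).val =
      if n < (x + 5 * t4) / 2 then (partialSum (m + 7) t3 t4 t5 (n - y)).val
      else if n < (3 * y + -1 * t3 + -1 * 1) / 2 then
        (partialSum (m + 7) t3 t4 t5 (n - y)).val + (n - (x + 5 * t4) / 2) + 1
      else if n < (3 * y + 1 * t3 + -1 * 1) / 2 then
        (partialSum (m + 8) z t3 t4 (n - y)).val + (blockSum (m + 7 : ℕ) t3 t4 t5).val +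
          (1 * z + -3 * t4 + -1 * 1) / 2
      else
        (partialSum (m + 9) y z t3 (n - y)).val + (blockSum (m + 7 : ℕ) t3 t4 t5).val +
          (blockSum (m + 8 : ℕ) z t3 t4).val + (1 * z + -3 * t4 + -1 * 1) / 2 := by
  obtain rfl : t3 = x - y - z := by omega
  obtain rfl : t4 = y - z - (x - y - z) := by omega
  obtain rfl : t5 = z - (x - y - z) - (y - z - (x - y - z)) := by omega
  rw [partialSum]
  simp only [Counted.bind_val, apply_ite Counted.val, cSub, cAdd, cMul, cDiv, cLt,
    decide_eq_true_eq, cLin_val]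

/-- Even the longest branch, with two block sums, uses fewer than 80 operations outside the
recursive call. -/
theorem partialSum_add_ten_cost_le {m B : ℕ}
    (h7 : ∀ x y z n, (partialSum (m + 7) x y z n).cost ≤ B)
    (h8 : ∀ x y z n, (partialSum (m + 8) x y z n).cost ≤ B)
    (h9 : ∀ x y z n, (partialSum (m + 9) x y z n).cost ≤ B) (x y z n : ℤ) :
    (partialSum (m + 10) x y z n).cost ≤ B + 80 := by
  rw [partialSum]
  simp only [Counted.bind_cost, cSub, cAdd, cMul, cDiv, cLt, decide_eq_true_eq]
  split_ifs
  · simp only [Counted.bind_cost, tick]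
    grw [h7]; omega
  · simp only [Counted.bind_cost, tick, cLin_cost, decide_eq_true_eq]
    split_ifs
    · simp only [Counted.bind_cost]
      grw [h7]; omega
    · simp only [Counted.bind_cost, cLin_cost, blockSum_cost, decide_eq_true_eq]
      split_ifs
      · simp only [Counted.bind_cost]
        grw [h8]; omega
      · simp only [Counted.bind_cost, blockSum_cost]
        grw [h9]; omega

theorem partialSum_cost_le (m : ℕ) (x y z n : ℤ) : (partialSum m x y z n).cost ≤ 80 * (m + 1) := by
  induction m using Nat.strong_induction_on generalizing x y z n with
  | _ m ih =>
    by_cases hm : m < 10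
    · have h1 : partialSum m x y z n = countUpTo n (ends m) := by interval_cases m <;> rfl
      have h2 : (ends m).length ≤ 8 := by interval_cases m <;> decide
      have h3 := countUpTo_cost_le n (ends m)
      rw [h1]; omega
    · obtain ⟨m, rfl⟩ : ∃ i, m = i + 10 := ⟨m - 10, by omega⟩
      refine (partialSum_add_ten_cost_le (B := 80 * (m + 10)) ?_ ?_ ?_ x y z n).trans (by omega)
      · intro x y z n
        exact (ih (m + 7) (by omega) x y z n).trans (by omega)
      · intro x y z n
        exact (ih (m + 8) (by omega) x y z n).trans (by omega)
      · intro x y z n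
        exact (ih (m + 9) (by omega) x y z n).trans (by omega)

/-- The thresholds of the case split and the number of ones, in terms of the block lengths. -/
theorem threshold_eqs (j : ℕ) :
    t (j + 7) + 5 * t (j + 3) = 2 * (palLen (j + 6) + 1 + lead (j + 7)) ∧
    3 * t (j + 6) = 2 * (palLen (j + 6) + 1 + t (j + 3)) + t (j + 4) + 1 ∧
    3 * t (j + 6) + t (j + 4) = 2 * (palLen (j + 6) + 1 + t (j + 3) + t (j + 4)) + 1 ∧
    t (j + 5) = 2 * ones (j + 7) + 3 * t (j + 3) + 1 := by
  have a3 := t_add_three (j + 3)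
  have a4 := t_add_three (j + 4)
  have p4 := palLen_succ (j + 3)
  have p5 := palLen_succ (j + 4)
  have p6 := palLen_succ (j + 5)
  have q := two_mul_palLen (j + 3)
  have hl := lead_add_ones j
  have ho := ones_add_seven j
  simp only [Nat.add_assoc, Nat.reduceAdd] at *
  omega

/-- Adding the value of `D` before the block avoids subtraction. Every branch is then `D_palLen_add`
at the offset of `n`, with the minimum resolved by the thresholds. -/
theorem partialSum_eq (j n : ℕ) (h1 : palLen (j + 6) < n) (h2 : n ≤ palLen (j + 7)) :
    (partialSum (j + 7) (t (j + 7)) (t (j + 6)) (t (j + 5)) n).val + D (palLen (j + 6)) = D n := by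
  induction j using Nat.strong_induction_on generalizing n with
  | _ j ih =>
    by_cases hj : j < 3
    · have h3 := palLen_strictMono.monotone (show j + 7 ≤ 9 by omega)
      have h4 : palLen 9 = 325 := by decide +kernel
      rw [partialSum_add_seven hj, D_eq_sum_take (by omega), D_eq_sum_take (by omega)]
      exact countUpTo_ends j hj n (by omega) h1 h2
    · obtain ⟨i, rfl⟩ : ∃ i, j = i + 3 := ⟨j - 3, by omega⟩
      have a5 : t (i + 8) = t (i + 7) + t (i + 6) + t (i + 5) := t_add_three (i + 5)
      have a6 : t (i + 9) = t (i + 8) + t (i + 7) + t (i + 6) := t_add_three (i + 6)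
      have a7 : t (i + 10) = t (i + 9) + t (i + 8) + t (i + 7) := t_add_three (i + 7)
      have p7 : palLen (i + 7) = palLen (i + 6) + t (i + 6) := palLen_succ (i + 6)
      have p8 : palLen (i + 8) = palLen (i + 7) + t (i + 7) := palLen_succ (i + 7)
      have p9 : palLen (i + 9) = palLen (i + 8) + t (i + 8) := palLen_succ (i + 8)
      have p10 : palLen (i + 10) = palLen (i + 9) + t (i + 9) := palLen_succ (i + 9)
      have hl : lead (i + 10) + ones (i + 10) = t (i + 6) := lead_add_ones (i + 3)
      obtain ⟨e1, e2, e3, e4⟩ := threshold_eqs (i + 3)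
      have s7 : D (palLen (i + 6)) + (dGamma (i + 7)).sum = D (palLen (i + 7)) :=
        D_palLen_add_sum (i + 3)
      have s8 : D (palLen (i + 7)) + (dGamma (i + 8)).sum = D (palLen (i + 8)) :=
        D_palLen_add_sum (i + 4)
      have hrec := D_palLen_add (i + 3) (n - palLen (i + 9))
      have b8 := blockSum_eq (i + 1)
      simp only [Nat.add_assoc, Nat.reduceAdd] at h1 h2 e1 e2 e3 e4 hrec b8 ⊢
      replace hrec := hrec (by omega)
      rw [show palLen (i + 9) + (n - palLen (i + 9)) = n by omega,
        show palLen (i + 6) + (n - palLen (i + 9)) = n - t (i + 9) by omega] at hrec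
      rw [partialSum_add_ten_val (t3 := t (i + 7)) (t4 := t (i + 6)) (t5 := t (i + 5)) i
        (by omega) (by omega) (by omega), blockSum_eq i, b8,
        show (n : ℤ) - t (i + 9) = ((n - t (i + 9) : ℕ) : ℤ) by omega,
        show ((t (i + 10) : ℤ) + 5 * t (i + 6)) / 2 = (palLen (i + 9) + 1 + lead (i + 10) : ℕ) by
          omega,
        show (3 * (t (i + 9) : ℤ) + -1 * t (i + 7) + -1 * 1) / 2 =
          (palLen (i + 9) + 1 + t (i + 6) : ℕ) by omega,
        show (3 * (t (i + 9) : ℤ) + 1 * t (i + 7) + -1 * 1) / 2 =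
          (palLen (i + 9) + 1 + t (i + 6) + t (i + 7) : ℕ) by omega,
        show (1 * (t (i + 8) : ℤ) + -3 * t (i + 6) + -1 * 1) / 2 = ones (i + 10) by omega]
      clear e1 e2 e3 e4 b8 a5 a7
      simp only [Nat.cast_lt]
      split_ifs with c1 c2 c3
      · have := ih i (by omega) (n - t (i + 9)) (by omega) (by omega)
        rw [min_eq_left (by omega)] at hrec
        omega
      · have := ih i (by omega) (n - t (i + 9)) (by omega) (by omega)
        rw [min_eq_left (by omega)] at hrec
        omega
      · have := ih (i + 1) (by omega) (n - t (i + 9))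
          (by simp only [Nat.add_assoc, Nat.reduceAdd]; omega)
          (by simp only [Nat.add_assoc, Nat.reduceAdd]; omega)
        simp only [Nat.add_assoc, Nat.reduceAdd] at this
        rw [min_eq_right (by omega)] at hrec
        omega
      · have := ih (i + 2) (by omega) (n - t (i + 9))
          (by simp only [Nat.add_assoc, Nat.reduceAdd]; omega)
          (by simp only [Nat.add_assoc, Nat.reduceAdd]; omega)
        simp only [Nat.add_assoc, Nat.reduceAdd] at this
        rw [min_eq_right (by omega)] at hrec
        omega

/-! ### The search for the block and the total cost -/

theorem findBlock_spec (f j n : ℕ) (h1 : palLen (j + 9) < n) (h2 : n ≤ palLen (j + 10 + f)) :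
    ∃ i, palLen (i + 9) < n ∧ n ≤ palLen (i + 10) ∧
      (findBlock f (j + 10) (t (j + 10)) (t (j + 9)) (t (j + 8)) n).val =
        (i + 10, (t (i + 10) : ℤ), (t (i + 9) : ℤ), (t (i + 8) : ℤ)) ∧
      (findBlock f (j + 10) (t (j + 10)) (t (j + 9)) (t (j + 8)) n).cost + 7 * j ≤ 7 * i + 7 := by
  induction f generalizing j with
  | zero =>
    refine ⟨j, h1, h2, ?_, ?_⟩
    · rw [findBlock, Counted.pure_val]
    · rw [findBlock, Counted.pure_cost]; omega
  | succ f ih =>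
    have a := t_add_three (j + 8)
    -- This identifies the threshold computed in the round with `palLen (j + 10) + 1`, the start of
    -- the next block. A full round costs 7 operations.
    have p := two_mul_palLen (j + 9)
    simp only [Nat.add_assoc, Nat.reduceAdd] at a p
    rw [findBlock]
    simp only [Counted.bind_val, Counted.bind_cost, cSub, cAdd, cDiv, cLt, decide_eq_true_eq]
    rw [show (t (j + 10) : ℤ) + t (j + 9) + t (j + 8) = t (j + 11) by omega]
    split_ifs with hc
    · exact ⟨j, h1, by omega, rfl, by rw [Counted.pure_cost]; omega⟩
    · obtain ⟨i, i1, i2, i3, i4⟩ := ih (j + 1)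
        (by simp only [Nat.add_assoc, Nat.reduceAdd]; omega)
        (by rwa [show j + 1 + 10 + f = j + 10 + (f + 1) by omega])
      simp only [Nat.add_assoc, Nat.reduceAdd] at i3 i4
      refine ⟨i, i1, i2, i3, ?_⟩
      simp only [Counted.bind_cost, tick, Nat.add_assoc, Nat.reduceAdd]
      omega

/-- Doubling every two steps makes the block index logarithmic in `n`. -/
theorem two_pow_le_t (j : ℕ) : 2 ^ j ≤ t (2 * j) := by
  induction j with
  | zero => simp
  | succ j ih =>
    have h1 := t_lt_succ (2 * j)
    have h2 : t (2 * j + 2) ≥ t (2 * j + 1) + t (2 * j) := by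
      rcases j with _ | j
      · simp
      · have := t_add_three (2 * j + 1)
        rw [show 2 * (j + 1) = 2 * j + 2 by omega]
        simp only [Nat.add_assoc, Nat.reduceAdd] at *
        omega
    rw [pow_succ, show 2 * (j + 1) = 2 * j + 2 by omega]
    omega

theorem le_log_of_palLen_lt {i n : ℕ} (h : palLen (i + 1) < n) : i ≤ 2 * Nat.log 2 n + 1 := by
  have h1 := palLen_succ i
  have h2 := t_strictMono.monotone (show 2 * (i / 2) ≤ i by omega)
  have h3 := two_pow_le_t (i / 2)
  have h4 := Nat.le_log_of_pow_le (b := 2) (by norm_num) (show 2 ^ (i / 2) ≤ n by omega)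
  omega

/-- For `n ≥ 326` the algorithm finds the block of `n`, and its cost is linear in the index. -/
theorem algD_of_lt {n : ℕ} (hn : 325 < n) : (algD n).val = D n ∧
    (algD n).cost ≤ 2000 * (Nat.log 2 n + 1) := by
  have t10 : (504 : ℤ) = (t (0 + 10) : ℕ) := by decide +kernel
  have t9 : (274 : ℤ) = (t (0 + 9) : ℕ) := by decide +kernel
  have t8 : (149 : ℤ) = (t (0 + 8) : ℕ) := by decide +kernel
  have p9 : palLen (0 + 9) = 325 := by decide +kernel
  -- Strict growth of `palLen` shows that `n` rounds always suffice for the search.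
  have hbound : n ≤ palLen (0 + 10 + n) :=
    (palLen_strictMono.le_apply (x := n)).trans (palLen_strictMono.monotone (by omega))
  obtain ⟨i, i1, i2, i3, i4⟩ := findBlock_spec n 0 n (by omega) hbound
  have hlog := le_log_of_palLen_lt (i := i + 8) i1
  rw [← t10, ← t9, ← t8, zero_add] at i3 i4
  have a := t_add_three (i + 7)
  simp only [Nat.add_assoc, Nat.reduceAdd] at a
  rw [algD]
  simp only [Counted.bind_val, Counted.bind_cost, cLt, decide_eq_true_eq]
  rw [if_pos (by omega)]
  simp only [Counted.bind_val, Counted.bind_cost, i3, cSub, cAdd, prefixSum_cost]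
  constructor
  · rw [show (t (i + 10) : ℤ) - t (i + 9) - t (i + 8) = t (i + 7) by omega,
      show ((i + 10 : ℕ) : ℤ) - 1 = (i + 2 + 7 : ℕ) by omega]
    have h1 := prefixSum_eq (i + 2)
    have h2 := partialSum_eq (i + 3) n i1 i2
    simp only [Nat.add_assoc, Nat.reduceAdd] at h1 h2 ⊢
    omega
  · have := partialSum_cost_le (i + 10) (t (i + 10)) (t (i + 9)) (t (i + 8)) n
    omega

theorem algD_of_le {n : ℕ} (hn : n ≤ 325) : (algD n).val = D n ∧ (algD n).cost ≤ 25 := by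
  rw [algD]
  simp only [Counted.bind_val, Counted.bind_cost, cLt, decide_eq_true_eq]
  rw [if_neg (by omega), D_eq_sum_take (by omega)]
  have h := countUpTo_cost_le n (ends 7 ++ ends 8 ++ ends 9)
  have h' : (ends 7 ++ ends 8 ++ ends 9).length = 12 := by decide
  exact ⟨countUpTo_eq_D n (by omega), by omega⟩

end Trib

/-! ### Assembly of the main theorem -/

open Trib in
theorem mainTheorem6 :
    -- the counts are counts of finite sets, and `D` is the summatory function of `d`
    (∀ n, (cubesIn n).Finite ∧ (cubesAt n).Finite ∧ D n = ∑ i ∈ Finset.Icc 1 n, d i) ∧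
    -- the blocks `Γ_{m,1}`
    (∀ m, 7 ≤ m →
      (gammaMin m : ℚ) = ((t m : ℚ) + t (m - 2) - 1) / 2 ∧
      (gammaMax m : ℚ) = ((t (m + 1) : ℚ) + t (m - 1) - 3) / 2 ∧
      gammaMax m + 1 = gammaMin (m + 1)) ∧
    (∀ n, 52 ≤ n → ∃! m, 7 ≤ m ∧ n ∈ gamma m 1) ∧
    -- the indicator block has `lead m` zeros, `ones m` ones and `t_{m-2} + t_{m-3}` zeros
    (∀ m, 7 ≤ m →
      (lead m : ℚ) = (-(t (m - 2) : ℚ) + 5 * t (m - 4) + 1) / 2 ∧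
      (ones m : ℚ) = ((t (m - 2) : ℚ) - 3 * t (m - 4) - 1) / 2) ∧
    -- the values of `d`
    (∀ n, n ≤ 51 → d n = 0) ∧
    (gamma 7 1 = List.range' 52 44 ∧ dGamma 7 = rep 6 0 ++ [1] ++ rep 37 0) ∧
    (gamma 8 1 = List.range' 96 81 ∧
      dGamma 8 = rep 11 0 ++ [1, 1] ++ rep 30 0 ++ [1] ++ rep 37 0) ∧
    (gamma 9 1 = List.range' 177 149 ∧
      dGamma 9 = rep 20 0 ++ rep 4 1 ++ rep 6 0 ++ [1] ++ rep 48 0 ++ [1, 1] ++ rep 30 0 ++ [1] ++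
        rep 37 0) ∧
    (∀ m, 10 ≤ m →
      dGamma m = vadd (dGamma (m - 3) ++ dGamma (m - 2) ++ dGamma (m - 1))
        (rep (lead m) 0 ++ rep (ones m) 1 ++ rep (t (m - 2) + t (m - 3)) 0)) ∧
    -- the sums over the blocks
    (∀ m, 10 ≤ m →
      (dGamma m).sum
        = (dGamma (m - 3)).sum + (dGamma (m - 2)).sum + (dGamma (m - 1)).sum + ones m) ∧
    (∀ m, 7 ≤ m →
      D (gammaMin (m + 1)) = D (gammaMax m) ∧
      ((dGamma m).sum : ℚ)
        = (m : ℚ) / 22 * (7 * t m - 13 * t (m - 1) + t (m - 2))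
          + 1 / 44 * (-41 * t m + 74 * t (m - 1) - 7 * t (m - 2)) + 1 / 4 ∧
      D (gammaMax m) = ∑ j ∈ Finset.Icc 7 m, (dGamma j).sum ∧
      (D (gammaMax m) : ℚ)
        = (m : ℚ) / 44 * (9 * t m - 12 * t (m - 1) - 5 * t (m - 2))
          + 3 / 11 * (-2 * t m + 2 * t (m - 1) + t (m - 2)) + (m : ℚ) / 4) ∧
    -- the thresholds of the case split
    (∀ m, 7 ≤ m →
      (theta1 m : ℚ) = ((t m : ℚ) + t (m - 2) - 1) / 2 ∧
      (eta1 m : ℚ) = ((t m : ℚ) + 5 * t (m - 4)) / 2 ∧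
      (eta2 m : ℚ) = (3 * (t (m - 1) : ℚ) - t (m - 3) - 1) / 2 ∧
      (theta2 m : ℚ) = (3 * (t (m - 1) : ℚ) - t (m - 3) - 1) / 2 ∧
      (theta3 m : ℚ) = (3 * (t (m - 1) : ℚ) + t (m - 3) - 1) / 2 ∧
      theta1 m < eta1 m ∧ eta1 m < eta2 m ∧ eta2 m = theta2 m ∧ theta2 m < theta3 m ∧
      theta3 m < theta1 (m + 1)) ∧
    -- the recursion for the partial block sums
    (∀ n m, 326 ≤ n → 7 ≤ m → n ∈ gamma m 1 →
      10 ≤ m ∧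
      (theta1 m ≤ n → n < eta1 m →
        ∑ i ∈ Finset.Icc (gammaMin m) n, d i
          = (∑ i ∈ Finset.Icc (gammaMin (m - 3)) (n - t (m - 1)), d i)) ∧
      (eta1 m ≤ n → n < theta2 m →
        ∑ i ∈ Finset.Icc (gammaMin m) n, d i
          = (∑ i ∈ Finset.Icc (gammaMin (m - 3)) (n - t (m - 1)), d i) + (n - eta1 m + 1)) ∧
      (theta2 m ≤ n → n < theta3 m →
        ∑ i ∈ Finset.Icc (gammaMin m) n, d i
          = (∑ i ∈ Finset.Icc (gammaMin (m - 2)) (n - t (m - 1)), d i)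
            + (dGamma (m - 3)).sum + ones m) ∧
      (theta3 m ≤ n →
        ∑ i ∈ Finset.Icc (gammaMin m) n, d i
          = (∑ i ∈ Finset.Icc (gammaMin (m - 1)) (n - t (m - 1)), d i)
            + (dGamma (m - 3)).sum + (dGamma (m - 2)).sum + ones m) ∧
      D n = D (gammaMax (m - 1)) + (∑ i ∈ Finset.Icc (gammaMin m) n, d i)) ∧
    -- the algorithm computes `D(n)` in `O(log n)` elementary operations
    (∀ n, (algD n).val = (D n : ℤ)) ∧
    (∃ C : ℕ, ∀ n, (algD n).cost ≤ C * (Nat.log 2 n + 1)) := by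
  refine ⟨fun n => ⟨cubesIn_finite n, cubesAt_finite n, D_eq_sum n⟩, ?_, ?_, ?_,
    fun n hn => d_eq_zero_of_lt (by omega), ⟨?_, dGamma_seven⟩, ⟨?_, dGamma_eight⟩,
    ⟨?_, dGamma_nine⟩, ?_, ?_, ?_, ?_, ?_, ?_, ?_⟩
  · intro m hm
    obtain ⟨j, rfl⟩ : ∃ j, m = j + 7 := ⟨m - 7, by omega⟩
    have h1 := two_mul_palLen (j + 5)
    have h2 := two_mul_palLen (j + 6)
    rw [gammaMin_add_four (j + 3), gammaMax_add_four (j + 3)]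
    rw [show j + 7 + 1 = (j + 4) + 4 by omega, gammaMin_add_four (j + 4)]
    simp only [Nat.add_assoc, Nat.reduceAdd, show j + 7 - 1 = j + 6 by omega,
      show j + 7 - 2 = j + 5 by omega] at h1 h2 ⊢
    qify at h1 h2 ⊢
    exact ⟨by linarith, by linarith, trivial⟩
  · intro n hn
    obtain ⟨j, h1, h2⟩ := exists_palLen hn
    refine ⟨j + 7, ⟨by omega, (mem_gamma_add_four (k := j + 3)).mpr ⟨h1, h2⟩⟩, ?_⟩
    rintro m ⟨hm, hmem⟩
    obtain ⟨i, rfl⟩ : ∃ i, m = i + 7 := ⟨m - 7, by omega⟩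
    obtain ⟨h3, h4⟩ := (mem_gamma_add_four (k := i + 3)).mp hmem
    have h5 : i + 6 < j + 7 := palLen_strictMono.lt_iff_lt.mp (h3.trans_le h2)
    have h6 : j + 6 < i + 7 := palLen_strictMono.lt_iff_lt.mp (h1.trans_le h4)
    omega
  · intro m hm
    obtain ⟨j, rfl⟩ : ∃ j, m = j + 7 := ⟨m - 7, by omega⟩
    have h1 := lead_add_ones j
    obtain ⟨-, -, -, h2⟩ := threshold_eqs j
    rw [show j + 7 - 2 = j + 5 by omega, show j + 7 - 4 = j + 3 by omega]
    qify at *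
    exact ⟨by linarith, by linarith⟩
  · rw [gamma_add_four 3]; decide +kernel
  · rw [gamma_add_four 4]; decide +kernel
  · rw [gamma_add_four 5]; decide +kernel
  · intro m hm
    obtain ⟨i, rfl⟩ : ∃ i, m = i + 10 := ⟨m - 10, by omega⟩
    exact dGamma_rec i
  · intro m hm
    obtain ⟨i, rfl⟩ : ∃ i, m = i + 10 := ⟨m - 10, by omega⟩
    exact sum_dGamma_rec i
  · intro m hm
    obtain ⟨j, rfl⟩ : ∃ j, m = j + 7 := ⟨m - 7, by omega⟩
    have h1 := sum_dGamma_closed j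
    have h2 := D_palLen_closed j
    rw [gammaMax_add_four (j + 3), show j + 7 + 1 = (j + 4) + 4 by omega, gammaMin_add_four (j + 4),
      D_succ, d_palLen_add_one]
    simp only [Nat.add_assoc, Nat.reduceAdd, show j + 7 - 1 = j + 6 by omega,
      show j + 7 - 2 = j + 5 by omega]
    refine ⟨rfl, ?_, D_palLen_eq_sum j, ?_⟩
    · generalize (dGamma (j + 7)).sum = S at h1 ⊢
      qify at h1
      push_cast
      linear_combination h1 / 44
    · qify at h2
      push_cast
      linear_combination h2 / 44
  · intro m hm
    obtain ⟨j, rfl⟩ : ∃ j, m = j + 7 := ⟨m - 7, by omega⟩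
    have h1 := two_mul_palLen (j + 5)
    obtain ⟨e1, e2, e3, e4⟩ := threshold_eqs j
    have hl := lead_add_ones j
    have hlp := lead_pos j
    have hop := ones_pos j
    have htp := t_pos (j + 4)
    have htp' := t_pos (j + 5)
    have ht := t_add_three (j + 3)
    have p7 := palLen_succ (j + 6)
    have g : gammaMin (j + 7) = palLen (j + 6) + 1 := gammaMin_add_four (j + 3)
    have g' : gammaMin (j + 7 + 1) = palLen (j + 7) + 1 := gammaMin_add_four (j + 4)
    simp only [theta1, theta2, theta3, eta1, eta2, gamma, List.length_range', g, g',
      show j + 7 - 1 = j + 6 by omega, show j + 7 - 2 = j + 5 by omega,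
      show j + 7 - 3 = j + 4 by omega, show j + 7 - 4 = j + 3 by omega,
      show j + 4 - 1 = j + 3 by omega, show j + 5 - 1 = j + 4 by omega]
    simp only [Nat.add_assoc, Nat.reduceAdd] at h1 p7 ht
    refine ⟨?_, ?_, ?_, ?_, ?_, by omega, by omega, by omega, by omega, by omega⟩
    all_goals
      qify at h1 e1 e2 e3 hl
      push_cast
      linarith
  · intro n m hn hm hmem
    have hm10 : 10 ≤ m := by
      obtain ⟨i, rfl⟩ : ∃ i, m = i + 7 := ⟨m - 7, by omega⟩
      have h3 := ((mem_gamma_add_four (k := i + 3)).mp hmem).2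
      -- This is the end of Γ_9, so `n ≥ 326` forces the index to be at least `10`.
      have h4 : palLen 9 = 325 := by decide +kernel
      have h5 : 9 < i + 7 := palLen_strictMono.lt_iff_lt.mp (by rw [h4]; exact hn.trans h3)
      omega
    obtain ⟨i, rfl⟩ : ∃ i, m = i + 10 := ⟨m - 10, by omega⟩
    obtain ⟨h1, h2⟩ := (mem_gamma_add_four (k := i + 6)).mp hmem
    have a6 : t (i + 9) = t (i + 8) + t (i + 7) + t (i + 6) := t_add_three (i + 6)
    have p7 : palLen (i + 7) = palLen (i + 6) + t (i + 6) := palLen_succ (i + 6)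
    have p8 : palLen (i + 8) = palLen (i + 7) + t (i + 7) := palLen_succ (i + 7)
    have p9 : palLen (i + 9) = palLen (i + 8) + t (i + 8) := palLen_succ (i + 8)
    have p10 : palLen (i + 10) = palLen (i + 9) + t (i + 9) := palLen_succ (i + 9)
    have hl : lead (i + 10) + ones (i + 10) = t (i + 6) := lead_add_ones (i + 3)
    have s7 : D (palLen (i + 6)) + (dGamma (i + 7)).sum = D (palLen (i + 7)) :=
      D_palLen_add_sum (i + 3)
    have s8 : D (palLen (i + 7)) + (dGamma (i + 8)).sum = D (palLen (i + 8)) :=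
      D_palLen_add_sum (i + 4)
    have g7 : gammaMin (i + 7) = palLen (i + 6) + 1 := gammaMin_add_four (i + 3)
    have g8 : gammaMin (i + 8) = palLen (i + 7) + 1 := gammaMin_add_four (i + 4)
    have g9 : gammaMin (i + 9) = palLen (i + 8) + 1 := gammaMin_add_four (i + 5)
    have g10 : gammaMin (i + 10) = palLen (i + 9) + 1 := gammaMin_add_four (i + 6)
    have gx : gammaMax (i + 9) = palLen (i + 9) := gammaMax_add_four (i + 5)
    have hrec := D_palLen_add (i + 3) (n - palLen (i + 9))
    simp only [Nat.add_assoc, Nat.reduceAdd] at h1 h2 hrec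
    replace hrec := hrec (by omega)
    rw [show palLen (i + 9) + (n - palLen (i + 9)) = n by omega,
      show palLen (i + 6) + (n - palLen (i + 9)) = n - t (i + 9) by omega] at hrec
    have hn1 := D_add_sum_Icc h1.le
    simp only [theta1, theta2, theta3, eta1, gamma, List.length_range', g7, g8, g9, g10, gx,
      show i + 10 - 1 = i + 9 by omega, show i + 10 - 2 = i + 8 by omega,
      show i + 10 - 3 = i + 7 by omega, show i + 8 - 1 = i + 7 by omega,
      show i + 7 - 1 = i + 6 by omega]
    refine ⟨hm10, ?_, ?_, ?_, ?_, hn1.symm⟩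
    · intro c1 c2
      have hn2 := D_add_sum_Icc (show palLen (i + 6) ≤ n - t (i + 9) by omega)
      rw [min_eq_left (by omega)] at hrec
      omega
    · intro c1 c2
      have hn2 := D_add_sum_Icc (show palLen (i + 6) ≤ n - t (i + 9) by omega)
      rw [min_eq_left (by omega)] at hrec
      omega
    · intro c1 c2
      have hn2 := D_add_sum_Icc (show palLen (i + 7) ≤ n - t (i + 9) by omega)
      rw [min_eq_right (by omega)] at hrec
      omega
    · intro c1
      have hn2 := D_add_sum_Icc (show palLen (i + 8) ≤ n - t (i + 9) by omega)
      rw [min_eq_right (by omega)] at hrec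
      omega
  · intro n
    rcases le_or_gt n 325 with h | h
    · exact (algD_of_le h).1
    · exact (algD_of_lt h).1
  · refine ⟨2000, fun n => ?_⟩
    rcases le_or_gt n 325 with h | h
    · exact (algD_of_le h).2.trans (by omega)
    · exact (algD_of_lt h).2
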